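/- For real numbers $\theta,\phi,\alpha\in[0,\pi/2]$, $\beta\in[0,2\pi]$ and $\nu_1,\nu_2\in[0,1]$ with $\nu_1+\nu_2=1$, consider the two-qubit state (of rank $1$ or $2$) $$\rho=\nu_1|\psi_1\rangle\langle\psi_1|+\nu_2|\psi_2\rangle\langle\psi_2|,$$ $$|\psi_1\rangle=\cos\theta|00\rangle+\sin\theta|11\rangle,\qquad |\psi_2\rangle=\cos\phi\,(\cos\alpha|01\rangle+\sin\alpha|10\rangle)+e^{i\beta}\sin\phi\,(\sin\theta|00\rangle-\cos\theta|11\rangle).$$ For a measurement direction $\hat n=(\sin\xi\cos\tau,\sin\xi\sin\tau,\cos\xi)$ of Alice (who holds the first qubit), with $\xi,\tau\in\mathbb R$, let $$|{+\hat n}\rangle=\cos\tfrac{\xi}{2}|0\rangle+e^{i\tau}\sin\tfrac{\xi}{2}|1\rangle,\qquad |{-\hat n}\rangle=\sin\tfrac{\xi}{2}|0\rangle-e^{i\tau}\cos\tfrac{\xi}{2}|1\rangle,$$ and let $\mathcal M=(\langle{+\hat n}|\otimes 1)\,\rho\,(|{-\hat n}\rangle\otimes 1)$ be the off-diagonal block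 in $$\rho=|{+\hat n}\rangle\langle{+\hat n}|\otimes\tilde\rho_0^{\hat n}+|{-\hat n}\rangle\langle{-\hat n}|\otimes\tilde\rho_1^{\hat n}+|{+\hat n}\rangle\langle{-\hat n}|\otimes\mathcal M+|{-\hat n}\rangle\langle{+\hat n}|\otimes\mathcal M^\dagger .$$ A state is separable if it is a finite convex combination of products of one-qubit density matrices. 1. For all parameters in these ranges, if $\mathcal M=\mathcal M^\dagger$ for some direction $(\xi,\tau)$, then $\rho$ is separable. 2. If $\theta\neq\pi/4$, or $\theta=\pi/4$ and $\phi\in\{0,\pi/2\}$, then $\rho$ is separable if and only if there are $\xi,\tau$ with $\mathcal M=\mathcal M^\dagger$. 3. Every two-qubit density matrix $\sigma$ of rank at most $2$ can be brought by a local unitary transformation, $\sigma\mapsto(U\otimes V)\,\sigma\,(U\otimes V)^\dagger$, to a state $\rho$ of the above form (the normal form) in which $\theta=\pi/4$ occurs only with $\phi=0,\ \alpha=\pi/4$ (so $|\psi_2\rangle=(|01\rangle+|10\rangle)/\sqrt2$) or with $\phi=\pi/2$ (so $|\psi_2\rangle=(|00\rangle-|11\rangle)/\sqrt2$ up to a phase),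 and $\sigma$ is separable if and only if $\mathcal M=\mathcal M^\dagger$ for this $\rho$ and some $\xi,\tau$. -/

import Mathlib

open scoped Matrix Kronecker ComplexOrder

noncomputable section

namespace TwoQubit

/-- One-qubit operators, in the computational basis `|0⟩, |1⟩`. -/
abbrev Op1 := Matrix (Fin 2) (Fin 2) ℂ

/-- Two-qubit operators; the index `(i, j)` stands for `|i⟩ ⊗ |j⟩`, with Alice's qubit first. -/
abbrev Op2 := Matrix (Fin 2 × Fin 2) (Fin 2 × Fin 2) ℂ

/-- A density matrix: positive semidefinite of trace one. -/
def IsDensity {ι : Type} [Fintype ι] (ρ : Matrix ι ι ℂ) : Prop :=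
  ρ.PosSemidef ∧ ρ.trace = 1

/-- Separable states: finite convex combinations of products of one-qubit density matrices. -/
def IsSeparable (ρ : Op2) : Prop :=
  ρ ∈ convexHull ℝ {σ : Op2 | ∃ A B : Op1, IsDensity A ∧ IsDensity B ∧ σ = A ⊗ₖ B}

/-- `|i j⟩`. -/
def ket (i j : Fin 2) : Fin 2 × Fin 2 → ℂ := Pi.single (i, j) 1

/-- `|u⟩⟨v|`. -/
def ketbra {ι : Type} (u v : ι → ℂ) : Matrix ι ι ℂ := Matrix.vecMulVec u (star v)

/-- The parameters of the normal form: two weights and four angles. -/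
structure Params where
  ν₁ : ℝ
  ν₂ : ℝ
  θ : ℝ
  φ : ℝ
  α : ℝ
  β : ℝ

namespace Params

/-- `cos θ |00⟩ + sin θ |11⟩`. -/
def ψ₁ (p : Params) : Fin 2 × Fin 2 → ℂ :=
  (Real.cos p.θ : ℂ) • ket 0 0 + (Real.sin p.θ : ℂ) • ket 1 1

/-- `cos φ (cos α |01⟩ + sin α |10⟩) + e^{iβ} sin φ (sin θ |00⟩ - cos θ |11⟩)`. -/
def ψ₂ (p : Params) : Fin 2 × Fin 2 → ℂ :=
  (Real.cos p.φ : ℂ) • ((Real.cos p.α : ℂ) • ket 0 1 + (Real.sin p.α : ℂ) • ket 1 0) +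
    (Complex.exp (Complex.I * p.β) * (Real.sin p.φ : ℂ)) •
      ((Real.sin p.θ : ℂ) • ket 0 0 - (Real.cos p.θ : ℂ) • ket 1 1)

/-- `ρ = ν₁ |ψ₁⟩⟨ψ₁| + ν₂ |ψ₂⟩⟨ψ₂|`. -/
def state (p : Params) : Op2 :=
  (p.ν₁ : ℂ) • ketbra p.ψ₁ p.ψ₁ + (p.ν₂ : ℂ) • ketbra p.ψ₂ p.ψ₂

/-- The ranges of the parameters. -/
def InRange (p : Params) : Prop :=
  p.θ ∈ Set.Icc 0 (Real.pi / 2) ∧ p.φ ∈ Set.Icc 0 (Real.pi / 2) ∧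
  p.α ∈ Set.Icc 0 (Real.pi / 2) ∧ p.β ∈ Set.Icc 0 (2 * Real.pi) ∧
  p.ν₁ ∈ Set.Icc 0 1 ∧ p.ν₂ ∈ Set.Icc 0 1 ∧ p.ν₁ + p.ν₂ = 1

/-- The normal form: if `|ψ₁⟩` is maximally entangled (`θ = π/4`), then `|ψ₂⟩` is
`(|01⟩ + |10⟩)/√2` or, up to a phase, `(|00⟩ - |11⟩)/√2`. -/
def IsNormal (p : Params) : Prop :=
  p.InRange ∧
    (p.θ = Real.pi / 4 → (p.φ = 0 ∧ p.α = Real.pi / 4) ∨ p.φ = Real.pi / 2)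

end Params

/-- `|+n⟩` for the direction `n = (sin ξ cos τ, sin ξ sin τ, cos ξ)`. -/
def ketPlus (ξ τ : ℝ) : Fin 2 → ℂ :=
  ![(Real.cos (ξ / 2) : ℂ), (Real.sin (ξ / 2) : ℂ) * Complex.exp (Complex.I * τ)]

/-- `|-n⟩` for the direction `n = (sin ξ cos τ, sin ξ sin τ, cos ξ)`. -/
def ketMinus (ξ τ : ℝ) : Fin 2 → ℂ :=
  ![(Real.sin (ξ / 2) : ℂ), -((Real.cos (ξ / 2) : ℂ) * Complex.exp (Complex.I * τ))]

/-- The operator `(⟨u| ⊗ 1) ρ (|v⟩ ⊗ 1)` on Bob's qubit, for vectors `u`, `v` of Alice's. -/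
def aliceBlock (ρ : Op2) (u v : Fin 2 → ℂ) : Op1 :=
  Matrix.of fun j l => ∑ i, ∑ k, star (u i) * ρ (i, j) (k, l) * v k

/-- The off-diagonal block `𝓜` of `ρ` in Alice's measurement basis `|+n⟩, |-n⟩`. -/
def offDiag (ρ : Op2) (ξ τ : ℝ) : Op1 := aliceBlock ρ (ketPlus ξ τ) (ketMinus ξ τ)

/-- The decomposition of `ρ` along Alice's measurement basis; it shows that `offDiag` is the
block that multiplies `|+n⟩⟨-n|`, the diagonal blocks being Bob's conditional states. -/
theorem decomposition (ρ : Op2) (hρ : ρ.IsHermitian) (ξ τ : ℝ) :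
    ρ = ketbra (ketPlus ξ τ) (ketPlus ξ τ) ⊗ₖ aliceBlock ρ (ketPlus ξ τ) (ketPlus ξ τ) +
      ketbra (ketMinus ξ τ) (ketMinus ξ τ) ⊗ₖ aliceBlock ρ (ketMinus ξ τ) (ketMinus ξ τ) +
      ketbra (ketPlus ξ τ) (ketMinus ξ τ) ⊗ₖ offDiag ρ ξ τ +
      ketbra (ketMinus ξ τ) (ketPlus ξ τ) ⊗ₖ (offDiag ρ ξ τ)ᴴ := by
  have hadj : (offDiag ρ ξ τ)ᴴ = aliceBlock ρ (ketMinus ξ τ) (ketPlus ξ τ) := by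
    ext j l
    have h : ∀ a b, star (ρ a b) = ρ b a := fun a b => hρ.apply b a
    simp only [Matrix.conjTranspose_apply, offDiag, aliceBlock, Matrix.of_apply,
      Fin.sum_univ_two, star_add, StarMul.star_mul, star_star, h]
    ring
  have hcomp : ∀ i k, ketPlus ξ τ i * star (ketPlus ξ τ k) + ketMinus ξ τ i * star (ketMinus ξ τ k)
      = if i = k then 1 else 0 := by
    have he : Complex.exp (Complex.I * τ) * (starRingEnd ℂ) (Complex.exp (Complex.I * τ)) = 1 := by
      rw [← Complex.exp_conj, ← Complex.exp_add]; simp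
    have hc : (Real.cos (ξ / 2) : ℂ) ^ 2 + (Real.sin (ξ / 2) : ℂ) ^ 2 = 1 := by
      exact_mod_cast Real.cos_sq_add_sin_sq (ξ / 2)
    intro i k
    fin_cases i <;> fin_cases k <;>
      simp [ketPlus, ketMinus, -Complex.ofReal_cos, -Complex.ofReal_sin]
    · linear_combination hc
    · ring
    · ring
    · linear_combination ((Real.cos (ξ / 2) : ℂ) ^ 2 + (Real.sin (ξ / 2) : ℂ) ^ 2) * he + hc
  rw [hadj]
  ext ⟨i, j⟩ ⟨k, l⟩
  simp only [Matrix.add_apply, Matrix.kroneckerMap_apply, ketbra, Matrix.vecMulVec_apply,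
    Pi.star_apply, offDiag, aliceBlock, Matrix.of_apply]
  have key : ∀ P Q : Fin 2 → ℂ,
      P i * star (P k) * (∑ a, ∑ b, star (P a) * ρ (a, j) (b, l) * P b) +
      Q i * star (Q k) * (∑ a, ∑ b, star (Q a) * ρ (a, j) (b, l) * Q b) +
      P i * star (Q k) * (∑ a, ∑ b, star (P a) * ρ (a, j) (b, l) * Q b) +
      Q i * star (P k) * (∑ a, ∑ b, star (Q a) * ρ (a, j) (b, l) * P b) =
      ∑ a, ∑ b, (P i * star (P a) + Q i * star (Q a)) * ρ (a, j) (b, l) *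
        (P b * star (P k) + Q b * star (Q k)) := by
    intro P Q
    simp only [Fin.sum_univ_two]
    ring
  rw [key]
  simp only [hcomp]
  simp

end TwoQubit

end

/-!
Let `ρ = A diag(ν₁, ν₂) Aᴴ` with orthonormal columns in `A`. A vector `A x` is a product vector iff
`x` is isotropic for the symmetric matrix `S = Aᵀ (σ_y ⊗ σ_y) A / 2` (sign aside), and `ρ` is
separable iff `diag(ν₁, ν₂)` is a sum of `|x⟩⟨x|` with isotropic `x`. For such `x` the vector `S x`
is proportional to `(x₁, -x₀)`; summing gives `S diag(ν₁, ν₂) Sᴴ = |det S| diag(ν₂, ν₁)`, so the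
weighted matrix `T = diag(√ν₁, √ν₂) S diag(√ν₁, √ν₂)` has `T Tᴴ` scalar. Conversely, if `T Tᴴ` is
scalar, the orthogonal complement of an isotropic unit vector of `T` is again isotropic, and the
two vectors decompose `ρ` into two product vectors.

For the states of the theorem both this criterion and the hermiticity of `𝓜` reduce, up to
degenerate angles, to one equation for a phase, `e^{2iβ}` or `e^{2iτ}`. The normal form is the
Schmidt decomposition of one eigenvector followed by diagonal unitaries that adjust the phases of
the other. If both eigenvectors are maximally entangled, their coefficient matrices are unitary up
to scale, and diagonalizing the traceless unitary that relates them gives `φ = π/2`.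
-/

noncomputable section

namespace TwoQubit

open ComplexConjugate Matrix

section Ketbra

variable {ι κ μ : Type}

theorem ketbra_apply (u v : ι → ℂ) (i j : ι) : ketbra u v i j = u i * star (v j) := rfl

theorem ketbra_smul_smul (c : ℂ) (u : ι → ℂ) :
    ketbra (c • u) (c • u) = (‖c‖ ^ 2 : ℂ) • ketbra u u := by
  rw [ketbra, star_smul, smul_vecMulVec, vecMulVec_smul, smul_smul, Complex.star_def,
    Complex.mul_conj', ketbra]

theorem ketbra_sqrt_smul {c : ℝ} (hc : 0 ≤ c) (u : ι → ℂ) :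
    ketbra (√c • u) (√c • u) = c • ketbra u u := by
  rw [← Complex.coe_smul, ketbra_smul_smul, Complex.norm_of_nonneg (Real.sqrt_nonneg c),
    ← Complex.ofReal_pow, Real.sq_sqrt hc, Complex.coe_smul]

theorem mul_ketbra_mul_conjTranspose [Fintype ι] (A : Matrix κ ι ℂ) (u v : ι → ℂ) :
    A * ketbra u v * Aᴴ = ketbra (A *ᵥ u) (A *ᵥ v) := by
  rw [ketbra, mul_vecMulVec, vecMulVec_mul, ← star_mulVec, ketbra]

theorem mul_sum_ketbra_mul_conjTranspose [Fintype ι] [Fintype μ] (A : Matrix κ ι ℂ)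
    (w : μ → ι → ℂ) :
    A * (∑ k, ketbra (w k) (w k)) * Aᴴ = ∑ k, ketbra (A *ᵥ w k) (A *ᵥ w k) := by
  simp only [Matrix.mul_sum, Matrix.sum_mul, mul_ketbra_mul_conjTranspose]

theorem mul_diagonal_mul_conjTranspose [Fintype κ] [DecidableEq κ] (A : Matrix ι κ ℂ)
    (d : κ → ℂ) :
    A * diagonal d * Aᴴ = ∑ k, d k • ketbra (A.col k) (A.col k) := by
  ext i j
  simp only [mul_apply (M := A * diagonal d), mul_diagonal, conjTranspose_apply, Matrix.sum_apply,
    Matrix.smul_apply, ketbra_apply, col_apply, smul_eq_mul]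
  exact Finset.sum_congr rfl fun k _ => by ring

theorem sum_ketbra_col_mul_unitary [Fintype κ] [DecidableEq κ] (A : Matrix ι κ ℂ)
    {W : Matrix κ κ ℂ} (hW : W ∈ unitaryGroup κ ℂ) :
    ∑ k, ketbra ((A * W).col k) ((A * W).col k) = A * Aᴴ := by
  calc ∑ k, ketbra ((A * W).col k) ((A * W).col k) = A * W * (A * W)ᴴ := by
        simpa using (mul_diagonal_mul_conjTranspose (A * W) 1).symm
    _ = A * (W * star W) * Aᴴ := by
        simp only [conjTranspose_mul, star_eq_conjTranspose, Matrix.mul_assoc]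
    _ = A * Aᴴ := by rw [mem_unitaryGroup_iff.1 hW, Matrix.mul_one]

theorem trace_ketbra [Fintype ι] (u v : ι → ℂ) : (ketbra u v).trace = u ⬝ᵥ star v :=
  trace_vecMulVec u (star v)

theorem eq_zero_of_sum_ketbra_eq_zero [Finite ι] [Fintype κ] {w : κ → ι → ℂ}
    (h : ∑ k, ketbra (w k) (w k) = 0) (k : κ) : w k = 0 := by
  cases nonempty_fintype ι
  have htrace : ∑ k, w k ⬝ᵥ star (w k) = 0 := by
    simpa only [trace_sum, trace_ketbra, trace_zero] using congrArg trace h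
  rw [Finset.sum_eq_zero_iff_of_nonneg fun k _ => dotProduct_self_star_nonneg (w k)] at htrace
  exact dotProduct_self_star_eq_zero.1 (htrace k (Finset.mem_univ k))

theorem mulVec_mulVec_eq_of_sum_ketbra_eq [Fintype ι] [Fintype κ] [Fintype μ]
    [DecidableEq μ] {A : Matrix ι μ ℂ} {L : Matrix μ ι ℂ} (hL : L * A = 1) {D : Matrix μ μ ℂ}
    {w : κ → ι → ℂ} (h : ∑ k, ketbra (w k) (w k) = A * D * Aᴴ) (k : κ) :
    A *ᵥ (L *ᵥ w k) = w k := by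
  classical
  have hA : (1 - A * L) * A = 0 := by
    rw [Matrix.sub_mul, Matrix.one_mul, Matrix.mul_assoc, hL, Matrix.mul_one, sub_self]
  have hsum : ∑ k, ketbra ((1 - A * L) *ᵥ w k) ((1 - A * L) *ᵥ w k) = 0 := by
    rw [← mul_sum_ketbra_mul_conjTranspose, h, ← Matrix.mul_assoc, ← Matrix.mul_assoc, hA]
    simp only [Matrix.zero_mul]
  have hk := eq_zero_of_sum_ketbra_eq_zero hsum k
  rw [sub_mulVec, one_mulVec, ← mulVec_mulVec, sub_eq_zero] at hk
  exact hk.symm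

theorem sum_ketbra_mulVec_eq [Fintype ι] [Fintype κ] [Fintype μ]
    [DecidableEq μ] {A : Matrix ι μ ℂ} {L : Matrix μ ι ℂ} (hL : L * A = 1) {D : Matrix μ μ ℂ}
    {w : κ → ι → ℂ} (h : ∑ k, ketbra (w k) (w k) = A * D * Aᴴ) :
    ∑ k, ketbra (L *ᵥ w k) (L *ᵥ w k) = D := by
  rw [← mul_sum_ketbra_mul_conjTranspose, h]
  calc L * (A * D * Aᴴ) * Lᴴ = L * A * D * (L * A)ᴴ := by
        simp only [conjTranspose_mul, Matrix.mul_assoc]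
    _ = D := by rw [hL, conjTranspose_one, Matrix.one_mul, Matrix.mul_one]

theorem eq_or_eq_neg_of_vecMulVec_self_eq {R : Type} [CommRing R] [IsDomain R] {u v : ι → R}
    (h : vecMulVec u u = vecMulVec v v) : u = v ∨ u = -v := by
  have hmul (i j : ι) : u i * u j = v i * v j := congrFun₂ h i j
  by_cases hv : v = 0
  · refine .inl (funext fun i => ?_)
    simpa [hv] using hmul i i
  · obtain ⟨i, hi⟩ := Function.ne_iff.1 hv
    refine (mul_self_eq_mul_self_iff.1 (hmul i i)).imp (fun hu => funext fun j => ?_)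
      fun hu => funext fun j => ?_
    · exact mul_left_cancel₀ hi (by rw [← hmul, hu])
    · exact mul_left_cancel₀ hi (by rw [Pi.neg_apply]; linear_combination u j * hu - hmul i j)

theorem ketbra_self_eq_of_vecMulVec_self_eq {c : ℂ} {u v : ι → ℂ}
    (h : vecMulVec u u = c • vecMulVec v v) : ketbra u u = (‖c‖ : ℂ) • ketbra v v := by
  obtain ⟨s, rfl⟩ := IsAlgClosed.exists_pow_nat_eq c two_pos
  have hs : vecMulVec u u = vecMulVec (s • v) (s • v) := by
    rw [h, smul_vecMulVec, vecMulVec_smul, smul_smul, sq]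
  rw [norm_pow, Complex.ofReal_pow, ← ketbra_smul_smul]
  obtain rfl | rfl := eq_or_eq_neg_of_vecMulVec_self_eq hs
  · rfl
  · rw [ketbra, star_neg, neg_vecMulVec, vecMulVec_neg, neg_neg, ketbra]

end Ketbra

section ProductVectors

/-- The coefficient matrix of a vector of a tensor product with respect to the product basis; for
two qubits it is singular exactly if the vector is a product vector. -/
def coeffMatrix {m n : Type} (w : m × n → ℂ) : Matrix m n ℂ := of fun i j => w (i, j)

theorem coeffMatrix_injective {m n : Type} :
    Function.Injective (coeffMatrix : (m × n → ℂ) → Matrix m n ℂ) :=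
  fun _ _ h => funext fun ij => congrFun₂ h ij.1 ij.2

theorem coeffMatrix_smul {m n R : Type} [SMul R ℂ] (c : R) (w : m × n → ℂ) :
    coeffMatrix (c • w) = c • coeffMatrix w := rfl

theorem coeffMatrix_kronecker_mulVec {m n : Type} [Fintype m] [Fintype n] (U : Matrix m m ℂ)
    (V : Matrix n n ℂ) (w : m × n → ℂ) :
    coeffMatrix ((U ⊗ₖ V) *ᵥ w) = U * coeffMatrix w * Vᵀ := by
  have hw : w = vec (coeffMatrix w)ᵀ := rfl
  have hvec : ∀ C : Matrix n m ℂ, coeffMatrix (vec C) = Cᵀ := fun _ => rfl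
  rw [hw, kronecker_mulVec_vec, hvec, ← hw]
  simp only [transpose_mul, transpose_transpose, Matrix.mul_assoc]

theorem ketbra_mul_eq_kronecker {m n : Type} (u : m → ℂ) (v : n → ℂ) :
    ketbra (fun ij : m × n => u ij.1 * v ij.2) (fun ij => u ij.1 * v ij.2) =
      ketbra u u ⊗ₖ ketbra v v := by
  ext ⟨i, j⟩ ⟨k, l⟩
  simp only [ketbra_apply, kroneckerMap_apply, star_mul]
  ring

theorem exists_eq_vecMulVec_of_det_eq_zero {K : Type} [Field K] {C : Matrix (Fin 2) (Fin 2) K}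
    (h : C.det = 0) : ∃ u v, C = vecMulVec u v := by
  obtain ⟨y, hy, hyC⟩ := exists_vecMul_eq_zero_iff.2 h
  have hrows (j : Fin 2) : y 0 * C 0 j + y 1 * C 1 j = 0 := by
    simpa [vecMul, dotProduct, Fin.sum_univ_two] using congrFun hyC j
  by_cases hy1 : y 1 = 0
  · have hy0 : y 0 ≠ 0 := fun hy0 => hy (funext fun i => by fin_cases i <;> assumption)
    refine ⟨![0, 1], C 1, ext fun i j => ?_⟩
    fin_cases i
    · simpa [hy0, hy1, vecMulVec_apply] using hrows j
    · simp [vecMulVec_apply]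
  · refine ⟨![1, -(y 0 / y 1)], C 0, ext fun i j => ?_⟩
    fin_cases i
    · simp [vecMulVec_apply]
    · simp only [vecMulVec_apply, Fin.mk_one, cons_val_one, cons_val_fin_one]
      field_simp
      linear_combination hrows j

theorem exists_ketbra_eq_kronecker {w : Fin 2 × Fin 2 → ℂ} (h : (coeffMatrix w).det = 0) :
    ∃ u v, ketbra w w = ketbra u u ⊗ₖ ketbra v v := by
  obtain ⟨u, v, huv⟩ := exists_eq_vecMulVec_of_det_eq_zero h
  obtain rfl : w = fun ij => u ij.1 * v ij.2 := funext fun ij => congrFun₂ huv ij.1 ij.2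
  exact ⟨u, v, ketbra_mul_eq_kronecker u v⟩

end ProductVectors

section Separability

theorem exists_isDensity_smul_eq {ι : Type} [Fintype ι] [Nonempty ι]
    {A : Matrix ι ι ℂ} (hA : A.PosSemidef) :
    ∃ (B : Matrix ι ι ℂ) (t : ℝ), IsDensity B ∧ 0 ≤ t ∧ A = t • B := by
  classical
  by_cases h : A.trace = 0
  · let i : ι := Classical.arbitrary ι
    refine ⟨ketbra (Pi.single i 1) (Pi.single i 1), 0,
      ⟨posSemidef_vecMulVec_self_star _, ?_⟩, le_rfl, ?_⟩
    · simp [trace_ketbra]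
    · rw [zero_smul, hA.trace_eq_zero_iff.1 h]
  · obtain ⟨t, ht, htr⟩ := RCLike.nonneg_iff_exists_ofReal.1 hA.trace_nonneg
    have ht0 : t ≠ 0 := by rintro rfl; exact h (by simpa using htr.symm)
    refine ⟨t⁻¹ • A, t, ⟨hA.smul (inv_nonneg.2 ht), ?_⟩, ht, ?_⟩
    · rw [trace_smul, ← htr, Complex.real_smul]
      simp [ht0]
    · rw [smul_smul, mul_inv_cancel₀ ht0, one_smul]

theorem IsSeparable.trace_eq_one {ρ : Op2} (h : IsSeparable ρ) : ρ.trace = 1 := by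
  have hconvex : Convex ℝ {σ : Op2 | σ.trace = 1} :=
    (convex_singleton (1 : ℂ)).linear_preimage (traceLinearMap (Fin 2 × Fin 2) ℝ ℂ)
  refine convexHull_min ?_ hconvex h
  rintro _ ⟨A, B, hA, hB, rfl⟩
  exact (trace_kronecker A B).trans (by rw [hA.2, hB.2, one_mul])

theorem IsSeparable.exists_eq_sum_ketbra {ρ : Op2} (h : IsSeparable ρ) :
    ∃ (κ : Type) (_ : Fintype κ) (w : κ → Fin 2 × Fin 2 → ℂ),
      (∀ k, (coeffMatrix (w k)).det = 0) ∧ ρ = ∑ k, ketbra (w k) (w k) := by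
  refine convexHull_min (t := {ρ : Op2 | ∃ (κ : Type) (_ : Fintype κ)
    (w : κ → Fin 2 × Fin 2 → ℂ), (∀ k, (coeffMatrix (w k)).det = 0) ∧
      ρ = ∑ k, ketbra (w k) (w k)}) ?_ ?_ h
  · rintro _ ⟨A, B, hA, hB, rfl⟩
    obtain ⟨m, x, rfl⟩ := posSemidef_iff_eq_sum_vecMulVec.1 hA.1
    obtain ⟨n, y, rfl⟩ := posSemidef_iff_eq_sum_vecMulVec.1 hB.1
    refine ⟨Fin m × Fin n, inferInstance, fun k ij => x k.1 ij.1 * y k.2 ij.2,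
      fun k => det_vecMulVec _ _, ?_⟩
    change (∑ i, ketbra (x i) (x i)) ⊗ₖ (∑ j, ketbra (y j) (y j)) = _
    ext ⟨i, j⟩ ⟨k, l⟩
    simp only [ketbra_mul_eq_kronecker, Matrix.sum_apply, kroneckerMap_apply,
      Fintype.sum_prod_type, Finset.sum_mul_sum]
  · rintro _ ⟨κ, _, v, hv, rfl⟩ _ ⟨μ, _, w, hw, rfl⟩ a b ha hb -
    refine ⟨κ ⊕ μ, inferInstance, Sum.elim (fun k => √a • v k) (fun k => √b • w k), ?_, ?_⟩
    · rintro (k | k)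
      · rw [Sum.elim_inl, coeffMatrix_smul, det_smul_of_tower, hv, smul_zero]
      · rw [Sum.elim_inr, coeffMatrix_smul, det_smul_of_tower, hw, smul_zero]
    · simp only [Fintype.sum_sum_type, Sum.elim_inl, Sum.elim_inr, ketbra_sqrt_smul ha,
        ketbra_sqrt_smul hb, Finset.smul_sum]

theorem isSeparable_sum_ketbra {κ : Type} [Fintype κ] {w : κ → Fin 2 × Fin 2 → ℂ}
    (hw : ∀ k, (coeffMatrix (w k)).det = 0) (htrace : (∑ k, ketbra (w k) (w k)).trace = 1) :
    IsSeparable (∑ k, ketbra (w k) (w k)) := by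
  have hproduct (k : κ) : ∃ (σ : Op2) (t : ℝ), IsSeparable σ ∧ 0 ≤ t ∧
      ketbra (w k) (w k) = t • σ := by
    obtain ⟨u, v, huv⟩ := exists_ketbra_eq_kronecker (hw k)
    obtain ⟨A, s, hA, hs, hu⟩ := exists_isDensity_smul_eq (posSemidef_vecMulVec_self_star u)
    obtain ⟨B, t, hB, ht, hv⟩ := exists_isDensity_smul_eq (posSemidef_vecMulVec_self_star v)
    refine ⟨A ⊗ₖ B, s * t, subset_convexHull ℝ _ ⟨A, B, hA, hB, rfl⟩, mul_nonneg hs ht, ?_⟩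
    rw [huv, ketbra, ketbra, hu, hv, smul_kronecker, kronecker_smul, smul_smul]
  choose σ t hσ ht hwσ using hproduct
  simp only [hwσ] at htrace ⊢
  refine (convex_convexHull ℝ _).sum_mem (fun k _ => ht k) ?_ fun k _ => hσ k
  have hsum : ((∑ k, t k : ℝ) : ℂ) = 1 := by
    simpa [trace_sum, (hσ _).trace_eq_one] using htrace
  exact_mod_cast hsum

theorem isSeparable_iff_exists_sum_ketbra {ρ : Op2} :
    IsSeparable ρ ↔ ρ.trace = 1 ∧ ∃ (κ : Type) (_ : Fintype κ) (w : κ → Fin 2 × Fin 2 → ℂ),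
      (∀ k, (coeffMatrix (w k)).det = 0) ∧ ρ = ∑ k, ketbra (w k) (w k) := by
  refine ⟨fun h => ⟨h.trace_eq_one, h.exists_eq_sum_ketbra⟩, ?_⟩
  rintro ⟨htrace, κ, _, w, hw, rfl⟩
  exact isSeparable_sum_ketbra hw htrace

theorem IsSeparable.conj_kronecker {ρ : Op2} (h : IsSeparable ρ) {U V : Op1}
    (hU : U ∈ unitaryGroup (Fin 2) ℂ) (hV : V ∈ unitaryGroup (Fin 2) ℂ) :
    IsSeparable ((U ⊗ₖ V) * ρ * (U ⊗ₖ V)ᴴ) := by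
  obtain ⟨htrace, κ, _, w, hw, rfl⟩ := isSeparable_iff_exists_sum_ketbra.1 h
  refine isSeparable_iff_exists_sum_ketbra.2 ⟨?_, κ, _, fun k => (U ⊗ₖ V) *ᵥ w k, fun k => ?_,
    mul_sum_ketbra_mul_conjTranspose _ w⟩
  · rw [trace_mul_cycle, ← star_eq_conjTranspose,
      mem_unitaryGroup_iff'.1 (kronecker_mem_unitary hU hV), Matrix.one_mul, htrace]
  · rw [coeffMatrix_kronecker_mulVec, det_mul, det_mul, hw, mul_zero, zero_mul]

theorem isSeparable_conj_kronecker_iff {ρ : Op2} {U V : Op1}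
    (hU : U ∈ unitaryGroup (Fin 2) ℂ) (hV : V ∈ unitaryGroup (Fin 2) ℂ) :
    IsSeparable ((U ⊗ₖ V) * ρ * (U ⊗ₖ V)ᴴ) ↔ IsSeparable ρ := by
  refine ⟨fun h => ?_, fun h => h.conj_kronecker hU hV⟩
  have hstar : Uᴴ ⊗ₖ Vᴴ * U ⊗ₖ V = 1 := by
    rw [← conjTranspose_kronecker]
    exact mem_unitaryGroup_iff'.1 (kronecker_mem_unitary hU hV)
  convert h.conj_kronecker (Unitary.star_mem hU) (Unitary.star_mem hV) using 1
  calc ρ = (Uᴴ ⊗ₖ Vᴴ * U ⊗ₖ V) * ρ * (Uᴴ ⊗ₖ Vᴴ * U ⊗ₖ V)ᴴ := by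
        rw [hstar, conjTranspose_one, Matrix.one_mul, Matrix.mul_one]
    _ = _ := by simp only [conjTranspose_mul, Matrix.mul_assoc, star_eq_conjTranspose]

end Separability

section RankTwo

/-- The matrix `σ_y ⊗ σ_y / 2`, up to sign: the symmetric bilinear form on two-qubit vectors whose
quadratic form is the determinant of the coefficient matrix. -/
def spinFlip : Op2 := (1 / 2 : ℂ) • (!![0, 1; -1, 0] ⊗ₖ !![0, 1; -1, 0])

theorem dotProduct_spinFlip_mulVec (v w : Fin 2 × Fin 2 → ℂ) :
    v ⬝ᵥ spinFlip *ᵥ w =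
      (v (0, 0) * w (1, 1) - v (0, 1) * w (1, 0) - v (1, 0) * w (0, 1) + v (1, 1) * w (0, 0)) /
        2 := by
  simp only [dotProduct, mulVec, spinFlip, one_div, Matrix.smul_apply, kroneckerMap_apply,
    of_apply, cons_val', cons_val_fin_one, smul_eq_mul, Fintype.sum_prod_type, Fin.sum_univ_two,
    cons_val_zero, cons_val_one]
  ring

theorem det_coeffMatrix (w : Fin 2 × Fin 2 → ℂ) :
    (coeffMatrix w).det = w ⬝ᵥ spinFlip *ᵥ w := by
  rw [dotProduct_spinFlip_mulVec, det_fin_two]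
  simp only [coeffMatrix, of_apply]
  ring

variable {κ : Type}

/-- The Gram matrix of the columns of `A` with respect to `spinFlip`, from which Wootters'
concurrence is computed. -/
def concurrenceMatrix (A : Matrix (Fin 2 × Fin 2) κ ℂ) : Matrix κ κ ℂ := Aᵀ * spinFlip * A

theorem concurrenceMatrix_apply (A : Matrix (Fin 2 × Fin 2) κ ℂ) (k l : κ) :
    concurrenceMatrix A k l = A.col k ⬝ᵥ spinFlip *ᵥ A.col l := by
  rw [concurrenceMatrix, Matrix.mul_assoc]
  rfl

theorem concurrenceMatrix_isSymm (A : Matrix (Fin 2 × Fin 2) κ ℂ) :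
    (concurrenceMatrix A).IsSymm := by
  refine IsSymm.ext fun k l => ?_
  simp only [concurrenceMatrix_apply, dotProduct_spinFlip_mulVec]
  ring

theorem concurrenceMatrix_apply_self (A : Matrix (Fin 2 × Fin 2) κ ℂ) (k : κ) :
    concurrenceMatrix A k k = (coeffMatrix (A.col k)).det := by
  rw [concurrenceMatrix_apply, det_coeffMatrix]

theorem concurrenceMatrix_mul [Fintype κ] {μ : Type} (A : Matrix (Fin 2 × Fin 2) κ ℂ)
    (B : Matrix κ μ ℂ) :
    concurrenceMatrix (A * B) = Bᵀ * concurrenceMatrix A * B := by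
  simp only [concurrenceMatrix, transpose_mul, Matrix.mul_assoc]

theorem det_coeffMatrix_mulVec [Fintype κ] (A : Matrix (Fin 2 × Fin 2) κ ℂ) (x : κ → ℂ) :
    (coeffMatrix (A *ᵥ x)).det = x ⬝ᵥ concurrenceMatrix A *ᵥ x := by
  rw [det_coeffMatrix, concurrenceMatrix, ← mulVec_mulVec, ← mulVec_mulVec, mulVec_transpose,
    dotProduct_comm x, ← dotProduct_mulVec, dotProduct_comm]

theorem ketbra_mulVec_eq_of_isotropic {S : Op1} (hS : S.IsSymm) {x : Fin 2 → ℂ}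
    (hx : x ⬝ᵥ S *ᵥ x = 0) :
    ketbra (S *ᵥ x) (S *ᵥ x) = (‖S.det‖ : ℂ) • (adjugate (ketbra x x))ᵀ := by
  have hsymm : S 1 0 = S 0 1 := hS.apply 0 1
  have hiso : S 0 0 * x 0 ^ 2 + 2 * S 0 1 * x 0 * x 1 + S 1 1 * x 1 ^ 2 = 0 := by
    simp only [dotProduct, mulVec, Fin.sum_univ_two, hsymm] at hx
    linear_combination hx
  have hSx : vecMulVec (S *ᵥ x) (S *ᵥ x) = (-S.det) • vecMulVec ![x 1, -x 0] ![x 1, -x 0] := by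
    ext i j
    fin_cases i <;> fin_cases j <;>
      simp only [Fin.zero_eta, Fin.mk_one, vecMulVec_apply, mulVec, dotProduct, Fin.sum_univ_two,
        det_fin_two, hsymm, Matrix.smul_apply, smul_eq_mul, cons_val_zero, cons_val_one,
        cons_val_fin_one]
    · linear_combination S 0 0 * hiso
    · linear_combination S 0 1 * hiso
    · linear_combination S 0 1 * hiso
    · linear_combination S 1 1 * hiso
  rw [ketbra_self_eq_of_vecMulVec_self_eq hSx, norm_neg, adjugate_fin_two]
  ext i j
  fin_cases i <;> fin_cases j <;> simp [ketbra_apply]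

theorem mul_mul_conjTranspose_eq_of_isotropic [Fintype κ] {S : Op1} (hS : S.IsSymm)
    {x : κ → Fin 2 → ℂ} (hx : ∀ k, x k ⬝ᵥ S *ᵥ x k = 0) {R : Op1}
    (hR : ∑ k, ketbra (x k) (x k) = R) :
    S * R * Sᴴ = (‖S.det‖ : ℂ) • (adjugate R)ᵀ := by
  have hadj : ∑ k, (adjugate (ketbra (x k) (x k)))ᵀ = (adjugate R)ᵀ := by
    rw [← hR]
    ext i j
    fin_cases i <;> fin_cases j <;> simp [adjugate_fin_two, Matrix.sum_apply]
  rw [← hR, mul_sum_ketbra_mul_conjTranspose, hR, ← hadj, Finset.smul_sum]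
  exact Finset.sum_congr rfl fun k _ => ketbra_mulVec_eq_of_isotropic hS (hx k)

theorem exists_isotropic_unit_vector (S : Op1) :
    ∃ x : Fin 2 → ℂ, star x ⬝ᵥ x = 1 ∧ x ⬝ᵥ S *ᵥ x = 0 := by
  obtain ⟨v, hv, hSv⟩ : ∃ v : Fin 2 → ℂ, v ≠ 0 ∧ v ⬝ᵥ S *ᵥ v = 0 := by
    by_cases ha : S 0 0 = 0
    · exact ⟨![1, 0], by simp, by simp [ha, mulVec, dotProduct, Fin.sum_univ_two]⟩
    · obtain ⟨s, hs⟩ := IsAlgClosed.exists_pow_nat_eq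
        (discrim (S 0 0) (S 0 1 + S 1 0) (S 1 1)) two_pos
      obtain ⟨z, hz⟩ := exists_quadratic_eq_zero ha ⟨s, by rw [← hs, sq]⟩
      refine ⟨![z, 1], by simp, ?_⟩
      simp only [dotProduct, mulVec, Fin.sum_univ_two, cons_val_zero, cons_val_one]
      linear_combination hz
  obtain ⟨t, ht, hvt⟩ := RCLike.nonneg_iff_exists_ofReal.1 (dotProduct_star_self_nonneg v)
  have ht0 : t ≠ 0 := by
    rintro rfl
    exact hv (dotProduct_star_self_eq_zero.1 (by rw [← hvt, RCLike.ofReal_zero]))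
  refine ⟨(√t)⁻¹ • v, ?_, ?_⟩
  · rw [star_smul, smul_dotProduct, dotProduct_smul, ← hvt, smul_smul, star_trivial, ← mul_inv,
      Real.mul_self_sqrt ht]
    simp [ht0]
  · rw [mulVec_smul, smul_dotProduct, dotProduct_smul, hSv, smul_zero, smul_zero]

theorem isotropic_orthogonal {a h c x y : ℂ} (hnorm : ‖a‖ = ‖c‖)
    (horth : a * conj h + h * conj c = 0) (hxy : a * x ^ 2 + 2 * h * x * y + c * y ^ 2 = 0) :
    a * conj y ^ 2 - 2 * h * conj x * conj y + c * conj x ^ 2 = 0 := by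
  have hsq : a * conj a = c * conj c := by
    rw [Complex.mul_conj', Complex.mul_conj', hnorm]
  suffices hconj : conj a * y ^ 2 - 2 * conj h * x * y + conj c * x ^ 2 = 0 by
    simpa [map_ofNat] using congrArg conj hconj
  by_cases ha : a = 0
  · have hc : c = 0 := by simpa [ha] using hnorm.symm
    have hhxy : h = 0 ∨ x * y = 0 := by simpa [ha, hc, mul_assoc] using hxy
    rw [ha, hc, map_zero]
    rcases hhxy with rfl | hxy0
    · simp
    · linear_combination (-2 * conj h) * hxy0
  · refine (mul_eq_zero.1 ?_).resolve_left ha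
    linear_combination conj c * hxy + y ^ 2 * hsq - 2 * x * y * horth

/-- The two norm and orthogonality hypotheses say that `S * Sᴴ` is a scalar matrix. -/
theorem exists_unitary_isotropic_columns {S : Op1} (hS : S.IsSymm) (hnorm : ‖S 0 0‖ = ‖S 1 1‖)
    (horth : S 0 0 * conj (S 0 1) + S 0 1 * conj (S 1 1) = 0) :
    ∃ W ∈ unitaryGroup (Fin 2) ℂ, ∀ k, (Wᵀ * S * W) k k = 0 := by
  obtain ⟨x, hunit, hiso⟩ := exists_isotropic_unit_vector S
  have hsymm : S 1 0 = S 0 1 := hS.apply 0 1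
  simp only [dotProduct, mulVec, Fin.sum_univ_two, hsymm, Pi.star_apply, Complex.star_def]
    at hunit hiso
  refine ⟨!![x 0, -conj (x 1); x 1, conj (x 0)], mem_unitaryGroup_iff'.2 (ext fun i j => ?_),
    fun k => ?_⟩
  · fin_cases i <;> fin_cases j <;>
      simp only [star_eq_conjTranspose, Fin.zero_eta, Fin.mk_one, mul_apply, conjTranspose_apply,
        of_apply, cons_val', cons_val_zero, cons_val_one, cons_val_fin_one, Complex.star_def,
        Fin.sum_univ_two, map_neg, Complex.conj_conj, one_apply, if_true, zero_ne_one, one_ne_zero,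
        if_false]
    · linear_combination hunit
    · ring
    · ring
    · linear_combination hunit
  · have hiso' := isotropic_orthogonal hnorm horth (x := x 0) (y := x 1)
      (by linear_combination hiso)
    fin_cases k <;>
      simp only [Fin.zero_eta, Fin.mk_one, mul_apply, transpose_apply, of_apply, cons_val',
        cons_val_zero, cons_val_one, cons_val_fin_one, Fin.sum_univ_two, hsymm]
    · linear_combination hiso
    · linear_combination hiso'

section Criterion

variable {A : Matrix (Fin 2 × Fin 2) (Fin 2) ℂ} {p q : ℝ}

theorem mul_norm_eq_and_orthogonal_of_isSeparable (hA : Aᴴ * A = 1) (hp : 0 ≤ p) (hq : 0 ≤ q)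
    (hsep : IsSeparable (A * diagonal ![(p : ℂ), (q : ℂ)] * Aᴴ)) :
    p * ‖concurrenceMatrix A 0 0‖ = q * ‖concurrenceMatrix A 1 1‖ ∧
      p * concurrenceMatrix A 0 0 * conj (concurrenceMatrix A 0 1) +
        q * concurrenceMatrix A 0 1 * conj (concurrenceMatrix A 1 1) = 0 := by
  obtain ⟨κ, _, w, hw, hsum⟩ := hsep.exists_eq_sum_ketbra
  have hiso (k : κ) : (Aᴴ *ᵥ w k) ⬝ᵥ concurrenceMatrix A *ᵥ (Aᴴ *ᵥ w k) = 0 := by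
    rw [← det_coeffMatrix_mulVec, mulVec_mulVec_eq_of_sum_ketbra_eq hA hsum.symm, hw]
  have hS := mul_mul_conjTranspose_eq_of_isotropic (concurrenceMatrix_isSymm A) hiso
    (sum_ketbra_mulVec_eq hA hsum.symm)
  have hsymm : concurrenceMatrix A 1 0 = concurrenceMatrix A 0 1 :=
    (concurrenceMatrix_isSymm A).apply 0 1
  generalize concurrenceMatrix A = S at hS hsymm ⊢
  have hentry (i j : Fin 2) := congrFun₂ hS i j
  simp only [mul_apply (M := S * _), mul_diagonal, adjugate_fin_two, Fin.sum_univ_two,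
    conjTranspose_apply, transpose_apply, Matrix.smul_apply] at hentry
  have h00 : (p * ‖S 0 0‖ ^ 2 + q * ‖S 0 1‖ ^ 2 : ℂ) = q * ‖S.det‖ := by
    simpa [← Complex.mul_conj', mul_comm, mul_assoc] using hentry 0 0
  have h11 : (p * ‖S 0 1‖ ^ 2 + q * ‖S 1 1‖ ^ 2 : ℂ) = p * ‖S.det‖ := by
    simpa [hsymm, ← Complex.mul_conj', mul_comm, mul_assoc] using hentry 1 1
  constructor
  · norm_cast at h00 h11
    refine (sq_eq_sq₀ (by positivity) (by positivity)).1 ?_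
    linear_combination p * h00 - q * h11
  · simpa [hsymm, mul_comm, mul_left_comm] using hentry 0 1

theorem isSeparable_of_mul_norm_eq_of_orthogonal (hA : Aᴴ * A = 1) (hp : 0 ≤ p) (hq : 0 ≤ q)
    (hpq : p + q = 1) (hnorm : p * ‖concurrenceMatrix A 0 0‖ = q * ‖concurrenceMatrix A 1 1‖)
    (horth : p * concurrenceMatrix A 0 0 * conj (concurrenceMatrix A 0 1) +
        q * concurrenceMatrix A 0 1 * conj (concurrenceMatrix A 1 1) = 0) :
    IsSeparable (A * diagonal ![(p : ℂ), (q : ℂ)] * Aᴴ) := by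
  have hpp : (√p * √p : ℂ) = p := mod_cast Real.mul_self_sqrt hp
  have hqq : (√q * √q : ℂ) = q := mod_cast Real.mul_self_sqrt hq
  let r : Fin 2 → ℂ := ![√p, √q]
  have hrr : diagonal r * (diagonal r)ᴴ = diagonal ![(p : ℂ), (q : ℂ)] := by
    rw [diagonal_conjTranspose, diagonal_mul_diagonal]
    congr 1
    ext k
    fin_cases k <;> simp [r, hpp, hqq]
  have hS (i j : Fin 2) :
      concurrenceMatrix (A * diagonal r) i j = r i * concurrenceMatrix A i j * r j := by
    rw [concurrenceMatrix_mul, diagonal_transpose, mul_diagonal, diagonal_mul]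
  have hnorm_r : ‖concurrenceMatrix (A * diagonal r) 0 0‖ =
      ‖concurrenceMatrix (A * diagonal r) 1 1‖ := by
    have hr₀ : ‖r 0‖ * ‖r 0‖ = p := by simp [r, hp]
    have hr₁ : ‖r 1‖ * ‖r 1‖ = q := by simp [r, hq]
    rw [hS, hS, norm_mul, norm_mul, norm_mul, norm_mul, mul_right_comm, hr₀, hnorm, ← hr₁,
      mul_right_comm]
  obtain ⟨W, hW, hiso⟩ := exists_unitary_isotropic_columns
    (concurrenceMatrix_isSymm (A * diagonal r)) hnorm_r (by
      simp only [hS, r, map_mul, cons_val_zero, cons_val_one, cons_val_fin_one,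
        Complex.conj_ofReal]
      linear_combination (√p * √q : ℂ) * horth +
        √p * √q * concurrenceMatrix A 0 0 * conj (concurrenceMatrix A 0 1) * hpp +
        √p * √q * concurrenceMatrix A 0 1 * conj (concurrenceMatrix A 1 1) * hqq)
  have hsum := sum_ketbra_col_mul_unitary (A * diagonal r) hW
  have hstate : A * diagonal r * (A * diagonal r)ᴴ = A * diagonal ![(p : ℂ), (q : ℂ)] * Aᴴ := by
    simp only [← hrr, conjTranspose_mul, Matrix.mul_assoc]
  rw [← hstate, ← hsum]
  refine isSeparable_sum_ketbra (fun k => ?_) ?_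
  · rw [← concurrenceMatrix_apply_self, concurrenceMatrix_mul, hiso]
  · rw [hsum, hstate, trace_mul_cycle, hA, Matrix.one_mul, trace_diagonal]
    simpa using mod_cast hpq

theorem isSeparable_mul_diagonal_mul_conjTranspose_iff (hA : Aᴴ * A = 1) (hp : 0 ≤ p)
    (hq : 0 ≤ q) (hpq : p + q = 1) :
    IsSeparable (A * diagonal ![(p : ℂ), (q : ℂ)] * Aᴴ) ↔
      p * ‖concurrenceMatrix A 0 0‖ = q * ‖concurrenceMatrix A 1 1‖ ∧
        p * concurrenceMatrix A 0 0 * conj (concurrenceMatrix A 0 1) +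
          q * concurrenceMatrix A 0 1 * conj (concurrenceMatrix A 1 1) = 0 :=
  ⟨mul_norm_eq_and_orthogonal_of_isSeparable hA hp hq, fun ⟨hnorm, horth⟩ =>
    isSeparable_of_mul_norm_eq_of_orthogonal hA hp hq hpq hnorm horth⟩

end Criterion

end RankTwo

section Hermitian

theorem exp_I_mul (t : ℝ) : Complex.exp (Complex.I * t) = ⟨Real.cos t, Real.sin t⟩ := by
  rw [mul_comm, Complex.exp_mul_I, ← Complex.ofReal_cos, ← Complex.ofReal_sin,
    ← Complex.mk_eq_add_mul_I]

theorem exp_I_mul_mul_conj (t : ℝ) :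
    Complex.exp (Complex.I * t) * conj (Complex.exp (Complex.I * t)) = 1 := by
  rw [← Complex.exp_conj, ← Complex.exp_add, map_mul, Complex.conj_I, Complex.conj_ofReal,
    neg_mul, add_neg_cancel, Complex.exp_zero]

theorem norm_exp_I_mul (t : ℝ) : ‖Complex.exp (Complex.I * t)‖ = 1 := by
  rw [mul_comm, Complex.norm_exp_ofReal_mul_I]

theorem exp_I_mul_sq_eq_of_sin_sub_eq_zero {s t : ℝ} (h : Real.sin (s - t) = 0) :
    Complex.exp (Complex.I * s) ^ 2 = Complex.exp (Complex.I * t) ^ 2 := by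
  obtain ⟨n, hn⟩ := Real.sin_eq_zero_iff.1 h
  obtain rfl : s = t + n * Real.pi := by rw [hn, add_sub_cancel]
  rw [← Complex.exp_nat_mul, ← Complex.exp_nat_mul, Complex.exp_eq_exp_iff_exists_int]
  exact ⟨n, by push_cast; ring⟩

theorem cos_sq_add_sin_sq_ofReal (t : ℝ) : (Real.cos t ^ 2 + Real.sin t ^ 2 : ℂ) = 1 :=
  mod_cast Real.cos_sq_add_sin_sq t

theorem isHermitian_fin_two_iff {N : Op1} :
    N.IsHermitian ↔ (N 0 0).im = 0 ∧ (N 1 1).im = 0 ∧ N 0 1 = conj (N 1 0) := by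
  simp only [IsHermitian.ext_iff, Fin.forall_fin_two, Complex.star_def, Complex.conj_eq_iff_im]
  refine ⟨fun ⟨⟨h₀, h₁₀⟩, _, h₁⟩ => ⟨h₀, h₁, h₁₀.symm⟩,
    fun ⟨h₀, h₁, h₀₁⟩ => ⟨⟨h₀, h₀₁.symm⟩, ?_, h₁⟩⟩
  rw [h₀₁, Complex.conj_conj]

theorem offDiag_isHermitian_iff {ρ : Op2} (hρ : ρ.IsHermitian) (ξ τ : ℝ) :
    (offDiag ρ ξ τ).IsHermitian ↔
      (Complex.exp (Complex.I * τ) • ρ.submatrix (Prod.mk 0) (Prod.mk 1)).IsHermitian := by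
  suffices hsub : (offDiag ρ ξ τ)ᴴ - offDiag ρ ξ τ =
      Complex.exp (Complex.I * τ) • ρ.submatrix (Prod.mk 0) (Prod.mk 1) -
        (Complex.exp (Complex.I * τ) • ρ.submatrix (Prod.mk 0) (Prod.mk 1))ᴴ by
    rw [IsHermitian, ← sub_eq_zero, hsub, sub_eq_zero, eq_comm, IsHermitian]
  ext j l
  have hconj (a b : Fin 2 × Fin 2) : conj (ρ a b) = ρ b a := hρ.apply b a
  simp only [conjTranspose_apply, offDiag, aliceBlock, of_apply, Fin.sum_univ_two, star_add,
    star_mul, Complex.star_def, hconj, ketPlus, ketMinus, cons_val_zero, cons_val_one,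
    cons_val_fin_one, map_mul, map_neg, Complex.conj_ofReal, Complex.conj_conj, Matrix.sub_apply,
    Matrix.smul_apply, submatrix_apply, smul_eq_mul]
  linear_combination (Complex.exp (Complex.I * τ) * ρ (0, j) (1, l) -
    conj (Complex.exp (Complex.I * τ)) * ρ (1, j) (0, l)) * cos_sq_add_sin_sq_ofReal (ξ / 2)

end Hermitian

namespace Params

variable (p : Params)

theorem coeffMatrix_ψ₁ : coeffMatrix p.ψ₁ = diagonal ![↑(Real.cos p.θ), ↑(Real.sin p.θ)] := by
  ext i j
  fin_cases i <;> fin_cases j <;>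
    simp [coeffMatrix, ψ₁, ket, -Complex.ofReal_cos, -Complex.ofReal_sin]

theorem coeffMatrix_ψ₂ : coeffMatrix p.ψ₂ =
    !![Complex.exp (Complex.I * p.β) * Real.sin p.φ * Real.sin p.θ, Real.cos p.φ * Real.cos p.α;
      Real.cos p.φ * Real.sin p.α,
      -(Complex.exp (Complex.I * p.β) * Real.sin p.φ * Real.cos p.θ)] := by
  ext i j
  fin_cases i <;> fin_cases j <;>
    simp [coeffMatrix, ψ₂, ket, -Complex.ofReal_cos, -Complex.ofReal_sin]

/-- The matrix with columns `|ψ₁⟩` and `|ψ₂⟩`. -/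
def frame : Matrix (Fin 2 × Fin 2) (Fin 2) ℂ := (of ![p.ψ₁, p.ψ₂])ᵀ

theorem frame_apply_zero (i j : Fin 2) : p.frame (i, j) 0 =
    diagonal ![(Real.cos p.θ : ℂ), (Real.sin p.θ : ℂ)] i j :=
  congrFun₂ p.coeffMatrix_ψ₁ i j

theorem frame_apply_one (i j : Fin 2) : p.frame (i, j) 1 =
    !![Complex.exp (Complex.I * p.β) * Real.sin p.φ * Real.sin p.θ, Real.cos p.φ * Real.cos p.α;
      Real.cos p.φ * Real.sin p.α,
      -(Complex.exp (Complex.I * p.β) * Real.sin p.φ * Real.cos p.θ)] i j :=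
  congrFun₂ p.coeffMatrix_ψ₂ i j

theorem state_eq : p.state = p.frame * diagonal ![(p.ν₁ : ℂ), (p.ν₂ : ℂ)] * p.frameᴴ := by
  rw [mul_diagonal_mul_conjTranspose, Fin.sum_univ_two]
  rfl

theorem state_apply (a b : Fin 2 × Fin 2) : p.state a b =
    p.ν₁ * p.frame a 0 * conj (p.frame b 0) + p.ν₂ * p.frame a 1 * conj (p.frame b 1) := by
  simp only [state, Matrix.add_apply, Matrix.smul_apply, ketbra_apply, smul_eq_mul, mul_assoc]
  rfl

theorem state_isHermitian : p.state.IsHermitian := by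
  rw [state_eq]
  refine isHermitian_mul_mul_conjTranspose _ (isHermitian_diagonal_iff.2 fun k => ?_)
  fin_cases k <;> exact Complex.conj_ofReal _

theorem conjTranspose_frame_mul_frame : p.frameᴴ * p.frame = 1 := by
  have hβ := exp_I_mul_mul_conj p.β
  ext k l
  simp only [mul_apply, conjTranspose_apply, Fintype.sum_prod_type, Fin.sum_univ_two]
  fin_cases k <;> fin_cases l <;>
    simp only [Fin.zero_eta, Fin.mk_one, frame_apply_zero, frame_apply_one, diagonal_apply,
      of_apply, cons_val_zero, cons_val_one, cons_val_fin_one, Complex.star_def, map_mul, map_neg,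
      map_zero, Complex.conj_ofReal, one_apply, if_true, one_ne_zero, zero_ne_one, if_false]
  · linear_combination cos_sq_add_sin_sq_ofReal p.θ
  · ring
  · ring
  · linear_combination Real.sin p.φ ^ 2 * (Real.cos p.θ ^ 2 + Real.sin p.θ ^ 2 : ℂ) * hβ +
      Real.sin p.φ ^ 2 * cos_sq_add_sin_sq_ofReal p.θ +
      Real.cos p.φ ^ 2 * cos_sq_add_sin_sq_ofReal p.α + cos_sq_add_sin_sq_ofReal p.φ

theorem concurrenceMatrix_frame_zero_zero :
    concurrenceMatrix p.frame 0 0 = (Real.sin (2 * p.θ) / 2 : ℂ) := by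
  rw [concurrenceMatrix_apply_self, show p.frame.col 0 = p.ψ₁ from rfl, coeffMatrix_ψ₁,
    det_diagonal, Fin.prod_univ_two, Real.sin_two_mul]
  simp only [cons_val_zero, cons_val_one, cons_val_fin_one]
  push_cast
  ring

theorem concurrenceMatrix_frame_one_one :
    concurrenceMatrix p.frame 1 1 = -(Complex.exp (Complex.I * p.β) ^ 2 *
      (Real.sin p.φ ^ 2 * Real.sin (2 * p.θ)) + Real.cos p.φ ^ 2 * Real.sin (2 * p.α)) / 2 := by
  rw [concurrenceMatrix_apply_self, show p.frame.col 1 = p.ψ₂ from rfl, coeffMatrix_ψ₂,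
    det_fin_two_of, Real.sin_two_mul, Real.sin_two_mul]
  push_cast
  ring

theorem concurrenceMatrix_frame_zero_one :
    concurrenceMatrix p.frame 0 1 =
      -(Complex.exp (Complex.I * p.β) * (Real.sin p.φ * Real.cos (2 * p.θ))) / 2 := by
  rw [concurrenceMatrix_apply, dotProduct_spinFlip_mulVec, Real.cos_two_mul']
  simp only [col_apply, frame_apply_zero, frame_apply_one, diagonal_apply, of_apply,
    cons_val_zero, cons_val_one, cons_val_fin_one, if_true, one_ne_zero, zero_ne_one, if_false]
  push_cast
  ring

/-- The phase condition on which both sides of the criterion turn: up to degenerate cases, `𝓜` is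
Hermitian in a direction of azimuth `τ` if it holds at `t = τ`, and the state is separable if it
holds at `t = β`. -/
def PhaseCondition (t : ℝ) : Prop :=
  Complex.exp (Complex.I * t) ^ 2 *
      ↑((p.ν₁ - p.ν₂ * Real.sin p.φ ^ 2) * Real.sin (2 * p.θ)) =
    ↑(p.ν₂ * Real.cos p.φ ^ 2 * Real.sin (2 * p.α))

theorem offDiag_state_isHermitian_iff (ξ τ : ℝ) :
    (offDiag p.state ξ τ).IsHermitian ↔
      p.ν₂ * Real.sin (2 * p.φ) * Real.sin p.θ * Real.sin p.α * Real.sin (τ + p.β) = 0 ∧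
      p.ν₂ * Real.sin (2 * p.φ) * Real.cos p.θ * Real.cos p.α * Real.sin (τ - p.β) = 0 ∧
      p.PhaseCondition τ := by
  have hτ := exp_I_mul_mul_conj τ
  have hβ := exp_I_mul_mul_conj p.β
  rw [offDiag_isHermitian_iff p.state_isHermitian, isHermitian_fin_two_iff]
  simp only [Matrix.smul_apply, submatrix_apply, state_apply, frame_apply_zero, frame_apply_one,
    diagonal_apply, of_apply, cons_val_zero, cons_val_one, cons_val_fin_one, if_true, one_ne_zero,
    zero_ne_one, if_false, map_zero, smul_eq_mul]
  refine and_congr ?_ (and_congr ?_ ?_)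
  · rw [← mul_right_inj' (two_ne_zero' ℝ), mul_zero (2 : ℝ)]
    refine Eq.congr_left ?_
    rw [exp_I_mul, exp_I_mul, Real.sin_add, Real.sin_two_mul]
    simp only [Complex.mul_im, Complex.mul_re, Complex.add_im, Complex.add_re, Complex.conj_ofReal,
      map_mul, Complex.ofReal_re, Complex.ofReal_im, Complex.zero_re, Complex.zero_im]
    ring
  · rw [← mul_right_inj' (neg_ne_zero.2 (two_ne_zero' ℝ)), mul_zero (-2 : ℝ)]
    refine Eq.congr_left ?_
    rw [exp_I_mul, exp_I_mul, Real.sin_sub, Real.sin_two_mul]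
    simp only [Complex.mul_im, Complex.mul_re, Complex.add_im, Complex.add_re, Complex.conj_ofReal,
      map_mul, map_neg, Complex.neg_re, Complex.neg_im, Complex.conj_re, Complex.conj_im,
      Complex.ofReal_re, Complex.ofReal_im, Complex.zero_re, Complex.zero_im]
    ring
  · have hE : Complex.exp (Complex.I * τ) ≠ 0 := Complex.exp_ne_zero _
    rw [← mul_right_inj' hE, PhaseCondition, Real.sin_two_mul, Real.sin_two_mul]
    simp only [map_add, map_mul, map_neg, map_zero, Complex.conj_ofReal]
    push_cast
    constructor <;> intro h
    · linear_combination 2 * h + 2 * p.ν₂ * Complex.cos p.φ ^ 2 * Complex.sin p.α *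
        Complex.cos p.α * hτ + 2 * p.ν₂ * Complex.exp (Complex.I * τ) ^ 2 * Complex.sin p.φ ^ 2 *
        Complex.sin p.θ * Complex.cos p.θ * hβ
    · linear_combination h / 2 - p.ν₂ * Complex.cos p.φ ^ 2 * Complex.sin p.α *
        Complex.cos p.α * hτ - p.ν₂ * Complex.exp (Complex.I * τ) ^ 2 * Complex.sin p.φ ^ 2 *
        Complex.sin p.θ * Complex.cos p.θ * hβ

theorem concurrenceMatrix_frame_orthogonal_iff :
    p.ν₁ * concurrenceMatrix p.frame 0 0 * conj (concurrenceMatrix p.frame 0 1) +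
        p.ν₂ * concurrenceMatrix p.frame 0 1 * conj (concurrenceMatrix p.frame 1 1) = 0 ↔
      Real.sin p.φ * Real.cos (2 * p.θ) = 0 ∨ p.PhaseCondition p.β := by
  have hβ := exp_I_mul_mul_conj p.β
  have hβ0 : -conj (Complex.exp (Complex.I * p.β)) / 4 ≠ 0 :=
    div_ne_zero (neg_ne_zero.2 (right_ne_zero_of_mul_eq_one hβ)) four_ne_zero
  rw [← map_eq_zero conj, PhaseCondition, ← sub_eq_zero (b := Complex.ofReal _),
    ← Complex.ofReal_eq_zero, ← mul_eq_zero, ← mul_right_inj' hβ0 (b := Complex.ofReal _ * _),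
    mul_zero, concurrenceMatrix_frame_zero_zero, concurrenceMatrix_frame_zero_one,
    concurrenceMatrix_frame_one_one]
  refine Eq.congr_left ?_
  simp only [map_add, map_mul, map_neg, map_div₀, map_pow, map_ofNat, Complex.conj_ofReal,
    Complex.conj_conj]
  push_cast
  linear_combination p.ν₁ * Complex.sin (2 * p.θ) * Complex.sin p.φ * Complex.cos (2 * p.θ) *
    Complex.exp (Complex.I * p.β) / 4 * hβ

theorem isSeparable_state_iff_phaseCondition (h₁ : 0 ≤ p.ν₁) (h₂ : 0 ≤ p.ν₂)
    (hsum : p.ν₁ + p.ν₂ = 1) :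
    IsSeparable p.state ↔ p.PhaseCondition p.β ∨
      Real.sin p.φ * Real.cos (2 * p.θ) = 0 ∧
        p.ν₁ * |Real.sin (2 * p.θ)| = p.ν₂ * ‖Complex.exp (Complex.I * p.β) ^ 2 *
          (Real.sin p.φ ^ 2 * Real.sin (2 * p.θ)) + Real.cos p.φ ^ 2 * Real.sin (2 * p.α)‖ := by
  rw [state_eq, isSeparable_mul_diagonal_mul_conjTranspose_iff p.conjTranspose_frame_mul_frame
    h₁ h₂ hsum, concurrenceMatrix_frame_orthogonal_iff, concurrenceMatrix_frame_zero_zero,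
    concurrenceMatrix_frame_one_one, norm_div, norm_div, norm_neg, Complex.norm_real,
    Real.norm_eq_abs, Complex.norm_ofNat, ← mul_div_assoc, ← mul_div_assoc,
    div_left_inj' two_ne_zero]
  refine ⟨fun ⟨hnorm, horth⟩ => horth.symm.imp_right fun h => ⟨h, hnorm⟩, ?_⟩
  rintro (hphase | ⟨horth, hnorm⟩)
  · refine ⟨?_, .inr hphase⟩
    have hF : ‖Complex.exp (Complex.I * p.β) ^ 2‖ = 1 := by rw [norm_pow, norm_exp_I_mul, one_pow]
    have hsq : (p.ν₂ : ℂ) * (Complex.exp (Complex.I * p.β) ^ 2 *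
        (Real.sin p.φ ^ 2 * Real.sin (2 * p.θ)) + Real.cos p.φ ^ 2 * Real.sin (2 * p.α)) =
        Complex.exp (Complex.I * p.β) ^ 2 * (p.ν₁ * Real.sin (2 * p.θ)) := by
      rw [PhaseCondition] at hphase
      push_cast at hphase ⊢
      linear_combination -hphase
    simpa [hF, abs_of_nonneg h₁, abs_of_nonneg h₂, -Complex.ofReal_sin, -Complex.ofReal_cos]
      using (congrArg norm hsq).symm
  · exact ⟨hnorm, .inl horth⟩

variable {p}

theorem phaseCondition_iff_of_eq_zero {t : ℝ}
    (h : p.ν₂ * Real.cos p.φ ^ 2 * Real.sin (2 * p.α) = 0) :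
    p.PhaseCondition t ↔ (p.ν₁ - p.ν₂ * Real.sin p.φ ^ 2) * Real.sin (2 * p.θ) = 0 := by
  rw [PhaseCondition, h, Complex.ofReal_zero, mul_eq_zero, Complex.ofReal_eq_zero,
    or_iff_right (pow_ne_zero 2 (Complex.exp_ne_zero _))]

theorem PhaseCondition.abs_eq {t : ℝ} (h : p.PhaseCondition t) :
    |(p.ν₁ - p.ν₂ * Real.sin p.φ ^ 2) * Real.sin (2 * p.θ)| =
      |p.ν₂ * Real.cos p.φ ^ 2 * Real.sin (2 * p.α)| := by
  have hnorm := congrArg norm h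
  rwa [norm_mul, norm_pow, norm_exp_I_mul, one_pow, one_mul, Complex.norm_real,
    Complex.norm_real] at hnorm

theorem isSeparable_of_offDiag_isHermitian (h₁ : 0 ≤ p.ν₁) (h₂ : 0 ≤ p.ν₂)
    (hsum : p.ν₁ + p.ν₂ = 1) {ξ τ : ℝ} (h : (offDiag p.state ξ τ).IsHermitian) :
    IsSeparable p.state := by
  rw [isSeparable_state_iff_phaseCondition p h₁ h₂ hsum]
  obtain ⟨-, hsin, hphase⟩ := (p.offDiag_state_isHermitian_iff ξ τ).1 h
  by_cases hφ : Real.sin p.φ = 0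
  · refine .inr ⟨by rw [hφ, zero_mul], ?_⟩
    simpa [hφ, abs_mul, abs_of_nonneg h₁, abs_of_nonneg h₂, mul_assoc, -Complex.ofReal_sin,
      -Complex.ofReal_cos] using hphase.abs_eq
  left
  by_cases hα : p.ν₂ * Real.cos p.φ ^ 2 * Real.sin (2 * p.α) = 0
  · rw [phaseCondition_iff_of_eq_zero hα] at hphase ⊢
    exact hphase
  · have hθ : Real.cos p.θ ≠ 0 := fun hθ => hα <| abs_eq_zero.1 <| by
      rw [← hphase.abs_eq, Real.sin_two_mul, hθ, mul_zero, mul_zero, abs_zero]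
    rw [Real.sin_two_mul] at hα hsin
    simp only [mul_eq_zero, pow_eq_zero_iff two_ne_zero, not_or] at hα
    have hτβ : Real.sin (τ - p.β) = 0 := by simpa [hφ, hθ, hα] using hsin
    rwa [PhaseCondition, ← exp_I_mul_sq_eq_of_sin_sub_eq_zero hτβ]

theorem PhaseCondition.exists_offDiag_isHermitian (h : p.PhaseCondition p.β) :
    ∃ ξ τ, (offDiag p.state ξ τ).IsHermitian := by
  simp only [offDiag_state_isHermitian_iff, exists_const]
  by_cases hα : Real.cos p.α = 0
  · have hα' : p.ν₂ * Real.cos p.φ ^ 2 * Real.sin (2 * p.α) = 0 := by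
      rw [Real.sin_two_mul, hα, mul_zero, mul_zero]
    refine ⟨-p.β, by rw [neg_add_cancel, Real.sin_zero, mul_zero], by simp [hα], ?_⟩
    rwa [phaseCondition_iff_of_eq_zero hα'] at h ⊢
  · refine ⟨p.β, ?_, by rw [sub_self, Real.sin_zero, mul_zero], h⟩
    by_cases hβ : Real.sin (p.β + p.β) = 0
    · rw [hβ, mul_zero]
    · have him : (p.ν₁ - p.ν₂ * Real.sin p.φ ^ 2) * Real.sin (2 * p.θ) = 0 := by
        have := congrArg Complex.im h
        rw [Complex.im_mul_ofReal, Complex.ofReal_im, exp_I_mul, sq, Complex.mul_im] at this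
        refine (mul_eq_zero.1 this).resolve_left fun h0 => hβ ?_
        rw [Real.sin_add, ← h0]
        ring
      have hY : p.ν₂ * Real.cos p.φ ^ 2 * Real.sin (2 * p.α) = 0 := by
        rw [← abs_eq_zero, ← h.abs_eq, him, abs_zero]
      have hY' : (p.ν₂ = 0 ∨ Real.cos p.φ = 0) ∨ Real.sin p.α = 0 := by
        simpa [Real.sin_two_mul, hα] using hY
      rcases hY' with (h0 | h0) | h0 <;> simp [Real.sin_two_mul, h0]

theorem exists_phaseCondition_of_abs_eq
    (h : |(p.ν₁ - p.ν₂ * Real.sin p.φ ^ 2) * Real.sin (2 * p.θ)| =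
      |p.ν₂ * Real.cos p.φ ^ 2 * Real.sin (2 * p.α)|) : ∃ τ, p.PhaseCondition τ := by
  rcases abs_eq_abs.1 h with h | h
  · exact ⟨0, by rw [PhaseCondition, h, Complex.ofReal_zero, mul_zero, Complex.exp_zero, one_pow,
      one_mul]⟩
  · refine ⟨Real.pi / 2, ?_⟩
    rw [PhaseCondition, h, exp_I_mul, Real.cos_pi_div_two, Real.sin_pi_div_two]
    simp [show (⟨0, 1⟩ : ℂ) = Complex.I from rfl, -Complex.ofReal_sin, -Complex.ofReal_cos]

theorem exists_offDiag_isHermitian_of_isSeparable (h₁ : 0 ≤ p.ν₁) (h₂ : 0 ≤ p.ν₂)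
    (hsum : p.ν₁ + p.ν₂ = 1) (hθ : Real.cos (2 * p.θ) = 0 → Real.sin (2 * p.φ) = 0)
    (hsep : IsSeparable p.state) : ∃ ξ τ, (offDiag p.state ξ τ).IsHermitian := by
  obtain hphase | ⟨horth, hnorm⟩ := (p.isSeparable_state_iff_phaseCondition h₁ h₂ hsum).1 hsep
  · exact hphase.exists_offDiag_isHermitian
  have hφ : Real.sin (2 * p.φ) = 0 := (mul_eq_zero.1 horth).elim
    (fun h => by rw [Real.sin_two_mul, h, mul_zero, zero_mul]) hθ
  obtain ⟨τ, hτ⟩ : ∃ τ, p.PhaseCondition τ := by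
    refine exists_phaseCondition_of_abs_eq ?_
    rw [Real.sin_two_mul, mul_eq_zero, mul_eq_zero, or_iff_right two_ne_zero] at hφ
    rcases hφ with hφ | hφ
    · simpa [hφ, abs_mul, abs_of_nonneg h₁, abs_of_nonneg h₂, mul_assoc, -Complex.ofReal_sin,
        -Complex.ofReal_cos] using hnorm
    · have hφ' : Real.sin p.φ ^ 2 = 1 := by rw [Real.sin_sq, hφ]; ring
      have hK : (p.ν₁ - p.ν₂) * Real.sin (2 * p.θ) = 0 := by
        have hnorm' : p.ν₁ * |Real.sin (2 * p.θ)| = p.ν₂ * |Real.sin (2 * p.θ)| := by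
          simpa [hφ, ← Complex.ofReal_pow, hφ', norm_exp_I_mul, -Complex.ofReal_sin] using hnorm
        rw [← sub_eq_zero, ← sub_mul, mul_eq_zero, abs_eq_zero] at hnorm'
        exact mul_eq_zero.2 hnorm'
      rw [hφ', hφ, mul_one, hK]
      simp
  exact ⟨0, τ, (p.offDiag_state_isHermitian_iff 0 τ).2 ⟨by simp [hφ], by simp [hφ], hτ⟩⟩

theorem isSeparable_state_iff (h₁ : 0 ≤ p.ν₁) (h₂ : 0 ≤ p.ν₂) (hsum : p.ν₁ + p.ν₂ = 1)
    (hθ : Real.cos (2 * p.θ) = 0 → Real.sin (2 * p.φ) = 0) :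
    IsSeparable p.state ↔ ∃ ξ τ, (offDiag p.state ξ τ).IsHermitian :=
  ⟨exists_offDiag_isHermitian_of_isSeparable h₁ h₂ hsum hθ,
    fun ⟨_, _, h⟩ => isSeparable_of_offDiag_isHermitian h₁ h₂ hsum h⟩

end Params

section MatrixDecompositions

variable {n : Type} [Fintype n]

theorem exists_isometry_mul_diagonal_of_rank_le {A : Matrix n n ℂ} (hA : A.PosSemidef) {k : ℕ}
    (hrank : A.rank ≤ k) (hk : k ≤ Fintype.card n) :
    ∃ (F : Matrix n (Fin k) ℂ) (d : Fin k → ℝ), Fᴴ * F = 1 ∧ (∀ i, 0 ≤ d i) ∧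
      A = F * diagonal (fun i => (d i : ℂ)) * Fᴴ := by
  classical
  let l : n → ℝ := hA.isHermitian.eigenvalues
  let W : Matrix n n ℂ := hA.isHermitian.eigenvectorUnitary
  have hW : Wᴴ * W = 1 := mem_unitaryGroup_iff'.1 hA.isHermitian.eigenvectorUnitary.2
  have hspec : A = ∑ i, (l i : ℂ) • ketbra (W.col i) (W.col i) :=
    hA.isHermitian.spectral_theorem.trans <| (Unitary.conjStarAlgAut_apply _ _).trans <|
      mul_diagonal_mul_conjTranspose W _
  have hcard : (Finset.univ.filter fun i => l i ≠ 0).card ≤ k := by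
    rwa [hA.isHermitian.rank_eq_card_non_zero_eigs, Fintype.card_subtype] at hrank
  obtain ⟨t, hsupport, -, ht⟩ := Finset.exists_subsuperset_card_eq
    (Finset.filter_subset _ Finset.univ) hcard hk
  let e : Fin k ≃ t := (t.equivFinOfCardEq ht).symm
  have he : Function.Injective fun i => (e i : n) := Subtype.val_injective.comp e.injective
  refine ⟨W.submatrix id fun i => e i, fun i => l (e i), ?_,
    fun i => hA.eigenvalues_nonneg _, ?_⟩
  · change (Wᴴ * W).submatrix (fun i => (e i : n)) (fun i => e i) = 1
    rw [hW, submatrix_one _ he]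
  · rw [mul_diagonal_mul_conjTranspose]
    calc A = ∑ i ∈ t, (l i : ℂ) • ketbra (W.col i) (W.col i) := by
          refine hspec.trans (Finset.sum_subset t.subset_univ fun i _ hi => ?_).symm
          have hli : l i = 0 := by
            by_contra h
            exact hi (hsupport (Finset.mem_filter.2 ⟨Finset.mem_univ i, h⟩))
          rw [hli, Complex.ofReal_zero, zero_smul]
      _ = ∑ i : t, (l i : ℂ) • ketbra (W.col i) (W.col i) := (Finset.sum_coe_sort t _).symm
      _ = _ := (e.sum_comp _).symm

variable [DecidableEq n]

theorem exists_unitary_col_eq {v : n → n → ℂ} {s : Set n}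
    (hv : ∀ i ∈ s, ∀ j ∈ s, star (v i) ⬝ᵥ v j = if i = j then 1 else 0) :
    ∃ U ∈ unitaryGroup n ℂ, ∀ i ∈ s, U.col i = v i := by
  have hortho : Orthonormal ℂ (s.domRestrict fun i => WithLp.toLp 2 (v i)) := by
    refine orthonormal_iff_ite.2 fun i j => ?_
    simpa only [Set.domRestrict_apply, EuclideanSpace.inner_toLp_toLp, dotProduct_comm,
      Subtype.ext_iff] using hv i i.2 j j.2
  obtain ⟨b, hb⟩ := hortho.exists_orthonormalBasis_extension_of_card_eq finrank_euclideanSpace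
  refine ⟨_, (EuclideanSpace.basisFun n ℂ).toMatrix_orthonormalBasis_mem_unitary b,
    fun i hi => funext fun j => ?_⟩
  simp [Module.Basis.toMatrix_apply, hb i hi]

theorem exists_unitary_mul_diagonal_sqrt {B : Matrix n n ℂ} {l : n → ℝ}
    (hB : Bᴴ * B = diagonal fun i => (l i : ℂ)) :
    ∃ U ∈ unitaryGroup n ℂ, B = U * diagonal fun i => (√(l i) : ℂ) := by
  have hcol (i j : n) : star (B.col i) ⬝ᵥ B.col j = if i = j then (l i : ℂ) else 0 :=
    congrFun₂ hB i j
  have hl (i : n) : 0 ≤ l i := by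
    have := dotProduct_star_self_nonneg (B.col i)
    rw [hcol, if_pos rfl] at this
    exact_mod_cast this
  obtain ⟨U, hU, hUB⟩ : ∃ U ∈ unitaryGroup n ℂ, ∀ i ∈ {i | l i ≠ 0},
      U.col i = (√(l i) : ℂ)⁻¹ • B.col i := by
    refine exists_unitary_col_eq fun i hi j _ => ?_
    rw [star_smul, smul_dotProduct, dotProduct_smul, hcol]
    split_ifs with hij
    · have hi' : (√(l i) : ℂ) ≠ 0 := mod_cast (Real.sqrt_ne_zero (hl i)).2 hi
      have hsq : (√(l i) : ℂ) ^ 2 = l i := mod_cast Real.sq_sqrt (hl i)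
      subst hij
      simp only [star_inv₀, Complex.star_def, Complex.conj_ofReal, smul_eq_mul]
      field_simp
      exact hsq.symm
    · simp only [smul_zero]
  refine ⟨U, hU, ext fun j i => ?_⟩
  rw [mul_diagonal]
  by_cases hi : l i = 0
  · have hBi : B.col i = 0 := dotProduct_star_self_eq_zero.1 (by rw [hcol, if_pos rfl, hi]; simp)
    simpa [hi] using congrFun hBi j
  · have hi' : (√(l i) : ℂ) ≠ 0 := mod_cast (Real.sqrt_ne_zero (hl i)).2 hi
    have hUi : U j i = (√(l i) : ℂ)⁻¹ * B j i := congrFun (hUB i hi) j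
    rw [hUi, mul_comm, mul_inv_cancel_left₀ hi']

theorem exists_singularValueDecomposition (A : Matrix n n ℂ) :
    ∃ U ∈ unitaryGroup n ℂ, ∃ V ∈ unitaryGroup n ℂ, ∃ d : n → ℝ, (∀ i, 0 ≤ d i) ∧
      U * A * V = diagonal fun i => (d i : ℂ) := by
  have hA := isHermitian_conjTranspose_mul_self A
  have hdiag := hA.conjStarAlgAut_star_eigenvectorUnitary
  rw [Unitary.conjStarAlgAut_star_apply] at hdiag
  let V : Matrix n n ℂ := hA.eigenvectorUnitary
  have hAVA : (A * V)ᴴ * (A * V) = diagonal fun i => (hA.eigenvalues i : ℂ) := by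
    rw [conjTranspose_mul, Matrix.mul_assoc, ← Matrix.mul_assoc Aᴴ, ← Matrix.mul_assoc]
    exact hdiag
  obtain ⟨U, hU, hAV⟩ := exists_unitary_mul_diagonal_sqrt hAVA
  refine ⟨star U, Unitary.star_mem hU, V, hA.eigenvectorUnitary.2,
    fun i => √(hA.eigenvalues i), fun i => Real.sqrt_nonneg _, ?_⟩
  rw [Matrix.mul_assoc, hAV, ← Matrix.mul_assoc, mem_unitaryGroup_iff'.1 hU, Matrix.one_mul]

end MatrixDecompositions

section AnglesAndPhases

theorem exists_angle_cos_sin {x y : ℝ} (hx : 0 ≤ x) (hy : 0 ≤ y) :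
    ∃ a ∈ Set.Icc 0 (Real.pi / 2),
      √(x ^ 2 + y ^ 2) * Real.cos a = x ∧ √(x ^ 2 + y ^ 2) * Real.sin a = y := by
  have hnorm : ‖(⟨x, y⟩ : ℂ)‖ = √(x ^ 2 + y ^ 2) := by
    rw [Complex.norm_eq_sqrt_sq_add_sq]
  refine ⟨Complex.arg ⟨x, y⟩, ⟨Complex.arg_nonneg_iff.2 hy,
    (abs_le.1 (Complex.abs_arg_le_pi_div_two_iff.2 hx)).2⟩, ?_, ?_⟩
  · rw [← hnorm, Complex.norm_mul_cos_arg]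
  · rw [← hnorm, Complex.norm_mul_sin_arg]

theorem exists_spherical_angles {x y z : ℝ} (hx : 0 ≤ x) (hy : 0 ≤ y) (hz : 0 ≤ z)
    (h : x ^ 2 + y ^ 2 + z ^ 2 = 1) :
    ∃ φ ∈ Set.Icc 0 (Real.pi / 2), ∃ α ∈ Set.Icc 0 (Real.pi / 2),
      Real.cos φ * Real.cos α = x ∧ Real.cos φ * Real.sin α = y ∧ Real.sin φ = z := by
  obtain ⟨α, hα, hαx, hαy⟩ := exists_angle_cos_sin hx hy
  obtain ⟨φ, hφ, hφr, hφz⟩ := exists_angle_cos_sin (Real.sqrt_nonneg (x ^ 2 + y ^ 2)) hz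
  rw [Real.sq_sqrt (by positivity), h, Real.sqrt_one, one_mul] at hφr hφz
  exact ⟨φ, hφ, α, hα, by rw [hφr, hαx], by rw [hφr, hαy], hφz⟩

theorem exists_phase (z : ℂ) :
    ∃ t ∈ Set.Icc 0 (2 * Real.pi), z = Complex.exp (Complex.I * (t : ℝ)) * ‖z‖ := by
  have hz := Complex.norm_mul_exp_arg_mul_I z
  obtain h | h := le_or_gt 0 z.arg
  · refine ⟨z.arg, ⟨h, by linarith [Complex.arg_le_pi z, Real.pi_pos]⟩, ?_⟩
    rw [mul_comm Complex.I, mul_comm, hz]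
  · refine ⟨z.arg + 2 * Real.pi, ⟨by linarith [Complex.neg_pi_lt_arg z], by linarith⟩, ?_⟩
    rw [mul_comm Complex.I, mul_comm, Complex.ofReal_add, add_mul, Complex.exp_add]
    push_cast
    rw [Complex.exp_two_pi_mul_I, mul_one, hz]

theorem exists_common_phase (x y : ℂ) :
    ∃ q κ : ℂ, ‖q‖ = 1 ∧ ‖κ‖ = 1 ∧ q * x = κ * ‖x‖ ∧ conj q * y = κ * ‖y‖ := by
  obtain ⟨a, -, ha⟩ := exists_phase x
  obtain ⟨b, -, hb⟩ := exists_phase y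
  refine ⟨Complex.exp (Complex.I * ↑((b - a) / 2)), Complex.exp (Complex.I * ↑((a + b) / 2)),
    norm_exp_I_mul _, norm_exp_I_mul _, ?_, ?_⟩
  · conv_lhs => rw [ha]
    rw [← mul_assoc, ← Complex.exp_add]
    push_cast
    ring_nf
  · conv_lhs => rw [hb]
    rw [← mul_assoc, ← Complex.exp_conj, ← Complex.exp_add, map_mul, Complex.conj_I,
      Complex.conj_ofReal]
    push_cast
    ring_nf

end AnglesAndPhases

section NormalForm

theorem star_dotProduct_eq_trace_coeffMatrix {m n : Type} [Fintype m] [Fintype n]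
    (v w : m × n → ℂ) : star v ⬝ᵥ w = ((coeffMatrix v)ᴴ * coeffMatrix w).trace := by
  rw [← star_vec_dotProduct_vec]
  exact (comp_equiv_dotProduct_comp_equiv _ _ (Equiv.prodComm n m)).symm

theorem trace_conjTranspose_mul_of_unitary {m n : Type} [Fintype m] [Fintype n] [DecidableEq m]
    [DecidableEq n] {U : Matrix m m ℂ} {V : Matrix n n ℂ}
    (hU : U ∈ unitaryGroup m ℂ) (hV : V ∈ unitaryGroup n ℂ) (A B : Matrix m n ℂ) :
    ((U * A * V)ᴴ * (U * B * V)).trace = (Aᴴ * B).trace := by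
  calc ((U * A * V)ᴴ * (U * B * V)).trace
        = (star V * (Aᴴ * (star U * U) * B * V)).trace := by
        simp only [conjTranspose_mul, star_eq_conjTranspose, Matrix.mul_assoc]
    _ = (Aᴴ * B).trace := by
        rw [mem_unitaryGroup_iff'.1 hU, Matrix.mul_one, trace_mul_comm, Matrix.mul_assoc,
          mem_unitaryGroup_iff.1 hV, Matrix.mul_one]

theorem exists_schmidtDecomposition {A : Op1} (hA : (Aᴴ * A).trace = 1) :
    ∃ U ∈ unitaryGroup (Fin 2) ℂ, ∃ V ∈ unitaryGroup (Fin 2) ℂ, ∃ θ ∈ Set.Icc 0 (Real.pi / 2),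
      U * A * V = diagonal ![↑(Real.cos θ), ↑(Real.sin θ)] := by
  obtain ⟨U, hU, V, hV, d, hd, hUAV⟩ := exists_singularValueDecomposition A
  have hnorm : d 0 ^ 2 + d 1 ^ 2 = 1 := by
    rw [← trace_conjTranspose_mul_of_unitary hU hV, hUAV, diagonal_conjTranspose,
      diagonal_mul_diagonal, trace_diagonal, Fin.sum_univ_two] at hA
    simp only [Pi.star_apply, Complex.star_def, Complex.conj_ofReal, ← sq] at hA
    exact_mod_cast hA
  obtain ⟨θ, hθ, hcos, hsin⟩ := exists_angle_cos_sin (hd 0) (hd 1)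
  rw [hnorm, Real.sqrt_one, one_mul] at hcos hsin
  refine ⟨U, hU, V, hV, θ, hθ, ?_⟩
  rw [hUAV, hcos, hsin]
  congr 1
  ext i
  fin_cases i <;> rfl

theorem eq_of_trace_diagonal_mul_eq_zero {θ : ℝ} {G : Op1}
    (h : ((diagonal ![(Real.cos θ : ℂ), (Real.sin θ : ℂ)])ᴴ * G).trace = 0) :
    ∃ z : ℂ, G = !![z * Real.sin θ, G 0 1; G 1 0, -(z * Real.cos θ)] := by
  have horth : Real.cos θ * G 0 0 + Real.sin θ * G 1 1 = 0 := by
    rw [diagonal_conjTranspose, trace_fin_two, diagonal_mul, diagonal_mul] at h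
    simpa only [Pi.star_apply, Complex.star_def, cons_val_zero, cons_val_one, cons_val_fin_one,
      Complex.conj_ofReal] using h
  have hθ := cos_sq_add_sin_sq_ofReal θ
  refine ⟨Real.sin θ * G 0 0 - Real.cos θ * G 1 1, ext fun i j => ?_⟩
  fin_cases i <;> fin_cases j
  · change G 0 0 = _ * _
    linear_combination Real.cos θ * horth - G 0 0 * hθ
  · rfl
  · rfl
  · change G 1 1 = -(_ * _)
    linear_combination Real.sin θ * horth - G 1 1 * hθ

theorem diagonal_one_phase_mem_unitaryGroup {q : ℂ} (hq : ‖q‖ = 1) :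
    (diagonal ![1, q] : Op1) ∈ unitaryGroup (Fin 2) ℂ := by
  rw [mem_unitaryGroup_iff, star_eq_conjTranspose, diagonal_conjTranspose, diagonal_mul_diagonal,
    diagonal_eq_one, funext_iff]
  simp [Fin.forall_fin_two, Complex.mul_conj', hq]

theorem diagonal_phase_mul_mul_diagonal_phase {q : ℂ} (hq : ‖q‖ = 1) (A : Op1) :
    diagonal ![1, conj q] * A * diagonal ![1, q] =
      !![A 0 0, q * A 0 1; conj q * A 1 0, A 1 1] := by
  have hqq : q * conj q = 1 := by rw [Complex.mul_conj', hq]; norm_num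
  ext i j
  rw [mul_diagonal, diagonal_mul]
  fin_cases i <;> fin_cases j
  · simp
  · simp [mul_comm]
  · simp
  · change conj q * A 1 1 * q = A 1 1
    linear_combination A 1 1 * hqq

theorem sum_norm_sq_eq_one {θ : ℝ} {x y z : ℂ}
    (h : (!![z * Real.sin θ, x; y, -(z * Real.cos θ)]ᴴ *
      !![z * Real.sin θ, x; y, -(z * Real.cos θ)]).trace = 1) :
    ‖x‖ ^ 2 + ‖y‖ ^ 2 + ‖z‖ ^ 2 = 1 := by
  have hθ := cos_sq_add_sin_sq_ofReal θ
  suffices hc : (‖x‖ ^ 2 + ‖y‖ ^ 2 + ‖z‖ ^ 2 : ℂ) = 1 by exact_mod_cast hc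
  simp only [trace_fin_two, mul_apply, conjTranspose_apply, Fin.sum_univ_two, of_apply,
    cons_val_zero, cons_val_one, cons_val_fin_one, Complex.star_def, map_neg, map_mul,
    Complex.conj_ofReal] at h
  rw [← Complex.mul_conj', ← Complex.mul_conj', ← Complex.mul_conj']
  linear_combination h - z * conj z * hθ

theorem exists_angles_of_orthogonal {θ : ℝ} {F : Op1} (hF : (Fᴴ * F).trace = 1)
    (horth : ((diagonal ![(Real.cos θ : ℂ), (Real.sin θ : ℂ)])ᴴ * F).trace = 0) :
    ∃ φ ∈ Set.Icc 0 (Real.pi / 2), ∃ α ∈ Set.Icc 0 (Real.pi / 2),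
      ∃ β ∈ Set.Icc 0 (2 * Real.pi), ∃ q κ : ℂ, ‖q‖ = 1 ∧ ‖κ‖ = 1 ∧ ∀ ν₁ ν₂ : ℝ,
        diagonal ![1, conj q] * F * diagonal ![1, q] =
          κ • coeffMatrix (Params.mk ν₁ ν₂ θ φ α β).ψ₂ := by
  obtain ⟨z, hz⟩ := eq_of_trace_diagonal_mul_eq_zero horth
  rw [hz] at hF
  obtain ⟨φ, hφ, α, hα, hx, hy, hφz⟩ := exists_spherical_angles (norm_nonneg _) (norm_nonneg _)
    (norm_nonneg _) (sum_norm_sq_eq_one hF)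
  obtain ⟨q, κ, hq, hκ, hqx, hqy⟩ := exists_common_phase (F 0 1) (F 1 0)
  obtain ⟨β, hβ, hβz⟩ := exists_phase (conj κ * z)
  have hκz : κ * (Complex.exp (Complex.I * β) * ‖z‖) = z := by
    rw [norm_mul, Complex.norm_conj, hκ, one_mul] at hβz
    rw [← hβz, ← mul_assoc, Complex.mul_conj', hκ]
    simp
  refine ⟨φ, hφ, α, hα, β, hβ, q, κ, hq, hκ, fun ν₁ ν₂ => ?_⟩
  rw [diagonal_phase_mul_mul_diagonal_phase hq, Params.coeffMatrix_ψ₂, hqx, hqy, ← hx, ← hy, hφz,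
    hz]
  ext i j
  fin_cases i <;> fin_cases j
  · change z * _ = κ * (_ * _)
    linear_combination -Real.sin θ * hκz
  · exact congrArg (κ * ·) (Complex.ofReal_mul _ _)
  · exact congrArg (κ * ·) (Complex.ofReal_mul _ _)
  · change -(z * _) = κ * -(_ * _)
    linear_combination Real.cos θ * hκz

namespace Params

/-- `(e, f)` is turned into `(|ψ₁⟩, |ψ₂⟩)`, up to a phase of `|ψ₂⟩`, by local unitaries `U ⊗ Vᵀ`,
in terms of the coefficient matrices `E` and `F` of `e` and `f`. -/
def IsNormalFormOf (p : Params) (E F : Op1) : Prop :=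
  ∃ U ∈ unitaryGroup (Fin 2) ℂ, ∃ V ∈ unitaryGroup (Fin 2) ℂ,
    U * E * V = coeffMatrix p.ψ₁ ∧ ∃ c : ℂ, ‖c‖ = 1 ∧ U * F * V = c • coeffMatrix p.ψ₂

theorem exists_isNormalFormOf {E F : Op1} (hE : (Eᴴ * E).trace = 1) (hF : (Fᴴ * F).trace = 1)
    (hEF : (Eᴴ * F).trace = 0) :
    ∃ θ ∈ Set.Icc 0 (Real.pi / 2), ∃ φ ∈ Set.Icc 0 (Real.pi / 2),
      ∃ α ∈ Set.Icc 0 (Real.pi / 2), ∃ β ∈ Set.Icc 0 (2 * Real.pi), ∀ ν₁ ν₂ : ℝ,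
        (Params.mk ν₁ ν₂ θ φ α β).IsNormalFormOf E F := by
  obtain ⟨U, hU, V, hV, θ, hθ, hUEV⟩ := exists_schmidtDecomposition hE
  rw [← trace_conjTranspose_mul_of_unitary hU hV] at hF hEF
  rw [hUEV] at hEF
  obtain ⟨φ, hφ, α, hα, β, hβ, q, κ, hq, hκ, hF'⟩ := exists_angles_of_orthogonal hF hEF
  have hq' : ‖conj q‖ = 1 := by rw [Complex.norm_conj, hq]
  refine ⟨θ, hθ, φ, hφ, α, hα, β, hβ, fun ν₁ ν₂ => ⟨_,
    mul_mem (diagonal_one_phase_mem_unitaryGroup hq') hU, _,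
    mul_mem hV (diagonal_one_phase_mem_unitaryGroup hq), ?_, κ, hκ, ?_⟩⟩
  · calc diagonal ![1, conj q] * U * E * (V * diagonal ![1, q])
        = diagonal ![1, conj q] * (U * E * V) * diagonal ![1, q] := by
          simp only [Matrix.mul_assoc]
      _ = coeffMatrix (Params.mk ν₁ ν₂ θ φ α β).ψ₁ := by
          rw [hUEV, diagonal_phase_mul_mul_diagonal_phase hq, coeffMatrix_ψ₁]
          ext i j
          fin_cases i <;> fin_cases j <;> simp
  · rw [← hF' ν₁ ν₂]
    simp only [Matrix.mul_assoc]

end Params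

theorem exists_smul_isHermitian {W : Op1} (hW : W ∈ unitaryGroup (Fin 2) ℂ)
    (htrace : W.trace = 0) : ∃ δ : ℂ, ‖δ‖ = 1 ∧ (δ • W).IsHermitian := by
  have hdet : ‖W.det‖ = 1 := CStarRing.norm_of_mem_unitary (det_of_mem_unitary hW)
  have hadj : W.adjugate = -W := by
    rw [trace_fin_two, add_eq_zero_iff_eq_neg] at htrace
    rw [adjugate_fin_two]
    ext i j
    fin_cases i <;> fin_cases j <;> simp [htrace]
  have hstar : -W = W.det • Wᴴ := by
    rw [← hadj, ← one_mul W.adjugate, ← mem_unitaryGroup_iff'.1 hW, Matrix.mul_assoc, mul_adjugate,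
      mul_smul_one, star_eq_conjTranspose]
  obtain ⟨δ, hδ⟩ := IsAlgClosed.exists_pow_nat_eq (-conj W.det) two_pos
  have hnorm : ‖δ‖ = 1 := by
    rw [← pow_eq_one_iff_of_nonneg (norm_nonneg δ) two_ne_zero, ← norm_pow, hδ, norm_neg,
      Complex.norm_conj, hdet]
  have hδδ : δ * conj δ = 1 := by rw [Complex.mul_conj', hnorm]; norm_num
  have hdd : W.det * conj W.det = 1 := by rw [Complex.mul_conj', hdet]; norm_num
  refine ⟨δ, hnorm, ?_⟩
  calc (δ • W)ᴴ = conj δ • Wᴴ := conjTranspose_smul δ W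
    _ = -δ • W.det • Wᴴ := by
        rw [smul_smul]
        congr 1
        linear_combination W.det * conj δ * hδ - W.det * δ * hδδ - conj δ * hdd
    _ = δ • W := by rw [← hstar, neg_smul_neg]

theorem exists_unitary_diagonalization {W : Op1} (hW : W ∈ unitaryGroup (Fin 2) ℂ)
    (htrace : W.trace = 0) : ∃ P ∈ unitaryGroup (Fin 2) ℂ, ∃ c : ℂ, ‖c‖ = 1 ∧
      star P * W * P = c • diagonal ![1, -1] := by
  obtain ⟨δ, hδ, hH⟩ := exists_smul_isHermitian hW htrace
  have hdiag := hH.conjStarAlgAut_star_eigenvectorUnitary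
  rw [Unitary.conjStarAlgAut_star_apply] at hdiag
  have hzero := hH.trace_eq_sum_eigenvalues
  rw [trace_smul, htrace, smul_zero, Fin.sum_univ_two] at hzero
  let P : Op1 := hH.eigenvectorUnitary
  have hP : P ∈ unitaryGroup (Fin 2) ℂ := hH.eigenvectorUnitary.2
  have hPWP : star P * W * P = (δ⁻¹ * hH.eigenvalues 0) • diagonal ![1, -1] := by
    have hδ₀ : δ ≠ 0 := norm_ne_zero_iff.1 (by rw [hδ]; exact one_ne_zero)
    have hW' : star P * W * P = δ⁻¹ • diagonal (fun i => (hH.eigenvalues i : ℂ)) := by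
      refine (eq_inv_smul_iff₀ hδ₀).2 ?_
      rw [← Matrix.smul_mul, ← Matrix.mul_smul]
      exact hdiag
    rw [hW', mul_smul]
    congr 1
    ext i j
    fin_cases i <;> fin_cases j
    · simp
    · simp
    · simp
    · simpa using (eq_neg_of_add_eq_zero_right hzero.symm)
  have hunitary := det_of_mem_unitary (mul_mem (mul_mem (Unitary.star_mem hP) hW) hP)
  have hnorm := CStarRing.norm_of_mem_unitary hunitary
  rw [hPWP, det_smul, det_diagonal, Fintype.card_fin, Fin.prod_univ_two, norm_mul, norm_pow,
    cons_val_zero, cons_val_one, cons_val_fin_one, one_mul, norm_neg, norm_one, mul_one] at hnorm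
  exact ⟨P, hP, _, (pow_eq_one_iff_of_nonneg (norm_nonneg _) two_ne_zero).1 hnorm, hPWP⟩

namespace Params

theorem coeffMatrix_ψ₁_of_θ_eq_pi_div_four {p : Params} (hθ : p.θ = Real.pi / 4) :
    coeffMatrix p.ψ₁ = (√2 / 2 : ℂ) • 1 := by
  rw [coeffMatrix_ψ₁, hθ, Real.cos_pi_div_four, Real.sin_pi_div_four, smul_one_eq_diagonal]
  congr 1
  ext i
  fin_cases i <;> simp

theorem coeffMatrix_ψ₂_pi_div_four_pi_div_two (ν₁ ν₂ : ℝ) :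
    coeffMatrix (Params.mk ν₁ ν₂ (Real.pi / 4) (Real.pi / 2) 0 0).ψ₂ =
      (√2 / 2 : ℂ) • diagonal ![1, -1] := by
  rw [coeffMatrix_ψ₂]
  ext i j
  fin_cases i <;> fin_cases j <;> simp [-Complex.ofReal_cos, -Complex.ofReal_sin]

theorem isNormalFormOf_of_smul_one {E F U V U' V' : Op1} (hEF : (Eᴴ * F).trace = 0)
    (hU : U ∈ unitaryGroup (Fin 2) ℂ) (hV : V ∈ unitaryGroup (Fin 2) ℂ)
    (hU' : U' ∈ unitaryGroup (Fin 2) ℂ) (hV' : V' ∈ unitaryGroup (Fin 2) ℂ)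
    (hE : U * E * V = (√2 / 2 : ℂ) • 1) (hF : U' * F * V' = (√2 / 2 : ℂ) • 1) (ν₁ ν₂ : ℝ) :
    (Params.mk ν₁ ν₂ (Real.pi / 4) (Real.pi / 2) 0 0).IsNormalFormOf E F := by
  let W : Op1 := U * star U' * (star V' * V)
  have hW : W ∈ unitaryGroup (Fin 2) ℂ := mul_mem (mul_mem hU (Unitary.star_mem hU'))
    (mul_mem (Unitary.star_mem hV') hV)
  have hUFV : U * F * V = (√2 / 2 : ℂ) • W := by
    calc U * F * V = U * (star U' * U') * F * (V' * star V') * V := by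
          rw [mem_unitaryGroup_iff'.1 hU', mem_unitaryGroup_iff.1 hV', Matrix.mul_one,
            Matrix.mul_one]
      _ = U * star U' * (U' * F * V') * (star V' * V) := by simp only [Matrix.mul_assoc]
      _ = (√2 / 2 : ℂ) • W := by
          rw [hF, Matrix.mul_smul, Matrix.mul_one, Matrix.smul_mul]
  have hroot : (√2 / 2 : ℂ) ≠ 0 := by simp
  have htrace : W.trace = 0 := by
    rw [← trace_conjTranspose_mul_of_unitary hU hV, hE, hUFV, conjTranspose_smul,
      conjTranspose_one, Matrix.smul_mul, Matrix.one_mul, trace_smul, trace_smul] at hEF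
    simpa using hEF
  obtain ⟨P, hP, c, hc, hPWP⟩ := exists_unitary_diagonalization hW htrace
  refine ⟨star P * U, mul_mem (Unitary.star_mem hP) hU, V * P, mul_mem hV hP, ?_, c, hc, ?_⟩
  · calc star P * U * E * (V * P) = star P * (U * E * V) * P := by simp only [Matrix.mul_assoc]
      _ = (√2 / 2 : ℂ) • 1 := by
          rw [hE, Matrix.mul_smul, Matrix.mul_one, Matrix.smul_mul, mem_unitaryGroup_iff'.1 hP]
      _ = _ := (coeffMatrix_ψ₁_of_θ_eq_pi_div_four rfl).symm
  · calc star P * U * F * (V * P) = star P * (U * F * V) * P := by simp only [Matrix.mul_assoc]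
      _ = (√2 / 2 : ℂ) • c • diagonal ![1, -1] := by
          rw [hUFV, Matrix.mul_smul, Matrix.smul_mul, hPWP]
      _ = _ := by rw [coeffMatrix_ψ₂_pi_div_four_pi_div_two, smul_comm]

theorem IsNormalFormOf.exists_kronecker_mul_eq_state {p : Params} {e f : Fin 2 × Fin 2 → ℂ}
    (h : p.IsNormalFormOf (coeffMatrix e) (coeffMatrix f)) :
    ∃ U ∈ unitaryGroup (Fin 2) ℂ, ∃ V ∈ unitaryGroup (Fin 2) ℂ,
      (U ⊗ₖ V) * ((p.ν₁ : ℂ) • ketbra e e + (p.ν₂ : ℂ) • ketbra f f) * (U ⊗ₖ V)ᴴ = p.state := by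
  obtain ⟨U, hU, V, hV, he, c, hc, hf⟩ := h
  refine ⟨U, hU, Vᵀ, transpose_mem_unitaryGroup_iff.2 hV, ?_⟩
  replace he : (U ⊗ₖ Vᵀ) *ᵥ e = p.ψ₁ :=
    coeffMatrix_injective (by rw [coeffMatrix_kronecker_mulVec, transpose_transpose, he])
  replace hf : (U ⊗ₖ Vᵀ) *ᵥ f = c • p.ψ₂ := coeffMatrix_injective
    (by rw [coeffMatrix_kronecker_mulVec, transpose_transpose, hf, coeffMatrix_smul])
  rw [Matrix.mul_add, Matrix.add_mul, Matrix.mul_smul, Matrix.mul_smul, Matrix.smul_mul,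
    Matrix.smul_mul, mul_ketbra_mul_conjTranspose, mul_ketbra_mul_conjTranspose, he, hf,
    ketbra_smul_smul, hc, Complex.ofReal_one, one_pow, one_smul, state]

end Params

theorem exists_orthonormal_of_rank_le_two {ρ : Op2} (hρ : IsDensity ρ) (hrank : ρ.rank ≤ 2) :
    ∃ e f : Fin 2 × Fin 2 → ℂ, star e ⬝ᵥ e = 1 ∧ star f ⬝ᵥ f = 1 ∧ star e ⬝ᵥ f = 0 ∧
      ∃ ν₁ ν₂ : ℝ, 0 ≤ ν₁ ∧ 0 ≤ ν₂ ∧ ν₁ + ν₂ = 1 ∧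
        ρ = (ν₁ : ℂ) • ketbra e e + (ν₂ : ℂ) • ketbra f f := by
  obtain ⟨F, d, hF, hd, rfl⟩ := exists_isometry_mul_diagonal_of_rank_le hρ.1 hrank (by simp)
  have hcol (i j : Fin 2) : star (F.col i) ⬝ᵥ F.col j = (1 : Op1) i j := congrFun₂ hF i j
  refine ⟨F.col 0, F.col 1, hcol 0 0, hcol 1 1, hcol 0 1, d 0, d 1, hd 0, hd 1, ?_, ?_⟩
  · have htrace := hρ.2
    rw [trace_mul_comm, ← Matrix.mul_assoc, hF, Matrix.one_mul, trace_diagonal,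
      Fin.sum_univ_two] at htrace
    exact_mod_cast htrace
  · rw [mul_diagonal_mul_conjTranspose, Fin.sum_univ_two]

theorem Params.exists_isNormalFormOf_or_swap {E F : Op1} (hE : (Eᴴ * E).trace = 1)
    (hF : (Fᴴ * F).trace = 1) (hEF : (Eᴴ * F).trace = 0) {ν₁ ν₂ : ℝ} (hν₁ : 0 ≤ ν₁)
    (hν₂ : 0 ≤ ν₂) (hν : ν₁ + ν₂ = 1) :
    ∃ p : Params, p.InRange ∧ (p.θ = Real.pi / 4 → p.φ = Real.pi / 2) ∧
      ((p.ν₁ = ν₁ ∧ p.ν₂ = ν₂ ∧ p.IsNormalFormOf E F) ∨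
        (p.ν₁ = ν₂ ∧ p.ν₂ = ν₁ ∧ p.IsNormalFormOf F E)) := by
  have hFE : (Fᴴ * E).trace = 0 := by
    rw [← star_eq_zero, ← trace_conjTranspose, conjTranspose_mul, conjTranspose_conjTranspose, hEF]
  have hν₁' : ν₁ ∈ Set.Icc 0 1 := ⟨hν₁, by linarith⟩
  have hν₂' : ν₂ ∈ Set.Icc 0 1 := ⟨hν₂, by linarith⟩
  obtain ⟨θ, hθ, φ, hφ, α, hα, β, hβ, h⟩ := exists_isNormalFormOf hE hF hEF
  obtain ⟨θ', hθ', φ', hφ', α', hα', β', hβ', h'⟩ := exists_isNormalFormOf hF hE hFE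
  by_cases hne : θ ≠ Real.pi / 4
  · exact ⟨⟨ν₁, ν₂, θ, φ, α, β⟩, ⟨hθ, hφ, hα, hβ, hν₁', hν₂', hν⟩, fun heq => absurd heq hne,
      .inl ⟨rfl, rfl, h ν₁ ν₂⟩⟩
  by_cases hne' : θ' ≠ Real.pi / 4
  · exact ⟨⟨ν₂, ν₁, θ', φ', α', β'⟩, ⟨hθ', hφ', hα', hβ', hν₂', hν₁', by rwa [add_comm]⟩,
      fun heq => absurd heq hne', .inr ⟨rfl, rfl, h' ν₂ ν₁⟩⟩
  obtain ⟨U, hU, V, hV, hUEV, -⟩ := h ν₁ ν₂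
  obtain ⟨U', hU', V', hV', hUFV, -⟩ := h' ν₂ ν₁
  rw [coeffMatrix_ψ₁_of_θ_eq_pi_div_four (not_not.1 hne)] at hUEV
  rw [coeffMatrix_ψ₁_of_θ_eq_pi_div_four (not_not.1 hne')] at hUFV
  have hpi := Real.pi_pos
  exact ⟨⟨ν₁, ν₂, Real.pi / 4, Real.pi / 2, 0, 0⟩,
    ⟨⟨by positivity, by linarith⟩, ⟨by positivity, le_rfl⟩, ⟨le_rfl, by positivity⟩,
      ⟨le_rfl, by positivity⟩, hν₁', hν₂', hν⟩, fun _ => rfl,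
    .inl ⟨rfl, rfl, isNormalFormOf_of_smul_one hEF hU hV hU' hV' hUEV hUFV ν₁ ν₂⟩⟩

theorem exists_normalForm {ρ : Op2} (hρ : IsDensity ρ) (hrank : ρ.rank ≤ 2) :
    ∃ U ∈ unitaryGroup (Fin 2) ℂ, ∃ V ∈ unitaryGroup (Fin 2) ℂ, ∃ p : Params,
      p.InRange ∧ (p.θ = Real.pi / 4 → p.φ = Real.pi / 2) ∧
        (U ⊗ₖ V) * ρ * (U ⊗ₖ V)ᴴ = p.state := by
  obtain ⟨e, f, hee, hff, hef, ν₁, ν₂, hν₁, hν₂, hν, rfl⟩ :=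
    exists_orthonormal_of_rank_le_two hρ hrank
  rw [star_dotProduct_eq_trace_coeffMatrix] at hee hff hef
  obtain ⟨p, hp, hθ, ⟨rfl, rfl, h⟩ | ⟨rfl, rfl, h⟩⟩ :=
    Params.exists_isNormalFormOf_or_swap hee hff hef hν₁ hν₂ hν
  · obtain ⟨U, hU, V, hV, h⟩ := h.exists_kronecker_mul_eq_state
    exact ⟨U, hU, V, hV, p, hp, hθ, h⟩
  · obtain ⟨U, hU, V, hV, h⟩ := h.exists_kronecker_mul_eq_state
    exact ⟨U, hU, V, hV, p, hp, hθ, by rwa [add_comm]⟩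

end NormalForm

theorem Params.InRange.sin_two_mul_φ_eq_zero {p : Params} (h : p.InRange)
    (hφ : p.θ = Real.pi / 4 → p.φ = 0 ∨ p.φ = Real.pi / 2) (hθ : Real.cos (2 * p.θ) = 0) :
    Real.sin (2 * p.φ) = 0 := by
  have hθ' : 2 * p.θ = Real.pi / 2 := Real.injOn_cos
    ⟨by linarith [h.1.1], by linarith [h.1.2]⟩ ⟨by positivity, by linarith [Real.pi_pos]⟩
    (hθ.trans Real.cos_pi_div_two.symm)
  obtain h₀ | h₁ := hφ (by linarith)
  · rw [h₀, mul_zero, Real.sin_zero]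
  · rw [h₁, mul_div_cancel₀ _ two_ne_zero, Real.sin_pi]

end TwoQubit

end

theorem mainTheorem2_general :
    (∀ p : TwoQubit.Params, 0 ≤ p.ν₁ → 0 ≤ p.ν₂ → p.ν₁ + p.ν₂ = 1 →
      (∃ ξ τ : ℝ, (TwoQubit.offDiag p.state ξ τ).IsHermitian) → TwoQubit.IsSeparable p.state) ∧
    (∀ p : TwoQubit.Params, 0 ≤ p.ν₁ → 0 ≤ p.ν₂ → p.ν₁ + p.ν₂ = 1 →
      (Real.cos (2 * p.θ) = 0 → Real.sin (2 * p.φ) = 0) →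
      (TwoQubit.IsSeparable p.state ↔
        ∃ ξ τ : ℝ, (TwoQubit.offDiag p.state ξ τ).IsHermitian)) ∧
    (∀ ρ : TwoQubit.Op2, TwoQubit.IsDensity ρ → ρ.rank ≤ 2 →
      ∃ U ∈ Matrix.unitaryGroup (Fin 2) ℂ, ∃ V ∈ Matrix.unitaryGroup (Fin 2) ℂ,
        ∃ p : TwoQubit.Params, p.InRange ∧ (p.θ = Real.pi / 4 → p.φ = Real.pi / 2) ∧
          (U ⊗ₖ V) * ρ * (U ⊗ₖ V)ᴴ = p.state ∧
          (TwoQubit.IsSeparable ρ ↔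
            ∃ ξ τ : ℝ, (TwoQubit.offDiag p.state ξ τ).IsHermitian)) := by
  refine ⟨fun p hν₁ hν₂ hν ⟨_, _, hM⟩ => p.isSeparable_of_offDiag_isHermitian hν₁ hν₂ hν hM,
    fun p hν₁ hν₂ hν hθ => p.isSeparable_state_iff hν₁ hν₂ hν hθ, fun ρ hρ hrank => ?_⟩
  obtain ⟨U, hU, V, hV, p, hp, hθ, hstate⟩ := TwoQubit.exists_normalForm hρ hrank
  have ⟨_, _, _, _, hν₁, hν₂, hν⟩ := hp
  refine ⟨U, hU, V, hV, p, hp, hθ, hstate, ?_⟩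
  rw [← TwoQubit.isSeparable_conj_kronecker_iff hU hV, hstate]
  exact p.isSeparable_state_iff hν₁.1 hν₂.1 hν
    (hp.sin_two_mul_φ_eq_zero fun h => .inr (hθ h))

theorem mainTheorem2 :
    (∀ p : TwoQubit.Params, p.InRange →
      (∃ ξ τ : ℝ, (TwoQubit.offDiag p.state ξ τ).IsHermitian) → TwoQubit.IsSeparable p.state) ∧
    (∀ p : TwoQubit.Params, p.InRange →
      (p.θ = Real.pi / 4 → p.φ = 0 ∨ p.φ = Real.pi / 2) →
      (TwoQubit.IsSeparable p.state ↔
        ∃ ξ τ : ℝ, (TwoQubit.offDiag p.state ξ τ).IsHermitian)) ∧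
    (∀ ρ : TwoQubit.Op2, TwoQubit.IsDensity ρ → ρ.rank ≤ 2 →
      ∃ U ∈ Matrix.unitaryGroup (Fin 2) ℂ, ∃ V ∈ Matrix.unitaryGroup (Fin 2) ℂ,
        ∃ p : TwoQubit.Params, p.IsNormal ∧ (U ⊗ₖ V) * ρ * (U ⊗ₖ V)ᴴ = p.state ∧
          (TwoQubit.IsSeparable ρ ↔
            ∃ ξ τ : ℝ, (TwoQubit.offDiag p.state ξ τ).IsHermitian)) := by
  obtain ⟨hif, hiff, hnormal⟩ := mainTheorem2_general
  refine ⟨fun p ⟨_, _, _, _, hν₁, hν₂, hν⟩ => hif p hν₁.1 hν₂.1 hν,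
    fun p hp hφ => hiff p hp.2.2.2.2.1.1 hp.2.2.2.2.2.1.1 hp.2.2.2.2.2.2
      (hp.sin_two_mul_φ_eq_zero hφ), fun ρ hρ hrank => ?_⟩
  obtain ⟨U, hU, V, hV, p, hp, hθ, h⟩ := hnormal ρ hρ hrank
  exact ⟨U, hU, V, hV, p, ⟨hp, fun heq => .inr (hθ heq)⟩, h⟩
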